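/- Let $R$ be a commutative discrete valuation ring with maximal ideal $P$, let $n\in\mathbb{N}$, let $L=\{1,\dots,n\}$, and let $R\text{-mod}$ be the abelian category of finitely generated $R$-modules. For an $R$-module $M$ put $\mathrm{rad}^n M=P^nM$. For an exact structure $\mathcal{E}$ on $R\text{-mod}$ (whose exact sequences are short exact sequences of modules) let $\mathrm{Ext}^1_{\mathcal{E}}(X,Y)\subseteq \mathrm{Ext}^1_R(X,Y)$ be the $R$-submodule of classes of $\mathcal{E}$-exact sequences $0\to Y\to B\to X\to 0$. Consider the following exact structures on $R\text{-mod}$: $\mathcal{E}_L$ consists of the short exact sequences on which $\mathrm{Hom}_R(-,R/P^\ell)$ is exact for all $\ell\in L$; $\mathcal{E}'$ consists of the short exact sequences on which the functor $M\mapsto M_{\mathrm{tors}}$ (torsion submodule) is exact; and $\mathcal{E}'_L=\mathcal{E}_L\cap\mathcal{E}'$. Then: (1) For all $X,Y$ in $R\text{-mod}$, $$\mathrm{Ext}^1_{\mathcal{E}_L}(X,Y)=\mathrm{rad}^n\,\mathrm{Ext}^1_R(X,Y)\quad\text{and}\quad \mathrm{Ext}^1_{\mathcal{E}'_L}(X,Y)=\mathrm{rad}^n\,\mathrm{Ext}^1_{\mathcal{E}'}(X,Y).$$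 (2) For $\mathcal{E}\in\{\mathcal{E}_L,\mathcal{E}'_L\}$, every $\mathcal{E}$-exact sequence $0\to A\to B\to C\to 0$ and every $X$ in $R\text{-mod}$, the induced sequence $$\mathrm{Ext}^1_{\mathcal{E}}(X,A)\to \mathrm{Ext}^1_{\mathcal{E}}(X,B)\to \mathrm{Ext}^1_{\mathcal{E}}(X,C)\to 0$$ is exact. In particular, the exact categories $\mathcal{E}_L$ and $\mathcal{E}'_L$ are hereditary, i.e. their Yoneda groups $\mathrm{Ext}^m_{\mathcal{E}}(X,Y)$ vanish for all $m\ge 2$ and all $X,Y$ in $R\text{-mod}$. -/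

import Mathlib

open CategoryTheory CategoryTheory.Limits CategoryTheory.Abelian

universe w v u

namespace RelExt

section General

variable {C : Type u} [Category.{v} C] [Abelian C]

/-- The first maps of the members of a class of short complexes. -/
def inflations (conf : ObjectProperty (ShortComplex C)) : MorphismProperty C :=
  fun _ Y f => ∃ (Z : C) (g : Y ⟶ Z) (w : f ≫ g = 0), conf (ShortComplex.mk f g w)

/-- The second maps of the members of a class of short complexes. -/
def deflations (conf : ObjectProperty (ShortComplex C)) : MorphismProperty C :=
  fun Y _ g => ∃ (X : C) (f : X ⟶ Y) (w : f ≫ g = 0), conf (ShortComplex.mk f g w)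

variable (C) in
/-- A Quillen exact structure on the abelian category `C`, given by its class of conflations (the
`E`-exact sequences). As `C` is abelian, kernel-cokernel pairs are the short exact sequences. -/
@[ext]
structure ExactStructure where
  conf : ObjectProperty (ShortComplex C)
  shortExact : ∀ {S : ShortComplex C}, conf S → S.ShortExact
  of_iso : ∀ {S T : ShortComplex C}, (S ≅ T) → conf S → conf T
  id_inflation : ∀ X : C, inflations conf (𝟙 X)
  id_deflation : ∀ X : C, deflations conf (𝟙 X)
  comp_inflation : ∀ {X Y Z : C} (f : X ⟶ Y) (g : Y ⟶ Z),
    inflations conf f → inflations conf g → inflations conf (f ≫ g)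
  comp_deflation : ∀ {X Y Z : C} (f : X ⟶ Y) (g : Y ⟶ Z),
    deflations conf f → deflations conf g → deflations conf (f ≫ g)
  pushout_inflation : ∀ {A B A' B' : C} {f : A ⟶ B} {a : A ⟶ A'} {b : B ⟶ B'} {f' : A' ⟶ B'},
    IsPushout f a b f' → inflations conf f → inflations conf f'
  pullback_deflation : ∀ {B X B' X' : C} {g : B ⟶ X} {b : B' ⟶ B} {x : X' ⟶ X} {g' : B' ⟶ X'},
    IsPullback b g' g x → deflations conf g → deflations conf g'

namespace ExactStructure

variable (E : ExactStructure C)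

lemma conf_of_inflation {S : ShortComplex C} (hS : S.ShortExact) (h : inflations E.conf S.f) :
    E.conf S := by
  obtain ⟨Z, g, w, hc⟩ := h
  have hT := E.shortExact hc
  refine E.of_iso (S := ShortComplex.mk S.f g w) (ShortComplex.isoMk (Iso.refl _) (Iso.refl _)
    (hT.gIsCokernel.coconePointUniqueUpToIso hS.gIsCokernel) ?_ ?_) hc
  · simp
  · have := hT.gIsCokernel.comp_coconePointUniqueUpToIso_hom hS.gIsCokernel
      WalkingParallelPair.one
    simpa using this.symm

lemma conf_of_deflation {S : ShortComplex C} (hS : S.ShortExact) (h : deflations E.conf S.g) :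
    E.conf S := by
  obtain ⟨Z, g, w, hc⟩ := h
  have hT := E.shortExact hc
  refine E.of_iso (S := ShortComplex.mk g S.g w) (ShortComplex.isoMk
    (hT.fIsKernel.conePointUniqueUpToIso hS.fIsKernel) (Iso.refl _) (Iso.refl _) ?_ ?_) hc
  · have := hT.fIsKernel.conePointUniqueUpToIso_hom_comp hS.fIsKernel
      WalkingParallelPair.zero
    simpa using this
  · simp

/-- The intersection of two exact structures. -/
instance : Min (ExactStructure C) where
  min E F :=
    have infl {X Y : C} (f : X ⟶ Y) :
        inflations (E.conf ⊓ F.conf) f ↔ inflations E.conf f ∧ inflations F.conf f := by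
      constructor
      · rintro ⟨Z, g, w, h⟩
        exact ⟨⟨Z, g, w, h.1⟩, ⟨Z, g, w, h.2⟩⟩
      · rintro ⟨⟨Z, g, w, h⟩, h'⟩
        exact ⟨Z, g, w, h, F.conf_of_inflation (E.shortExact h) h'⟩
    have defl {X Y : C} (f : X ⟶ Y) :
        deflations (E.conf ⊓ F.conf) f ↔ deflations E.conf f ∧ deflations F.conf f := by
      constructor
      · rintro ⟨Z, g, w, h⟩
        exact ⟨⟨Z, g, w, h.1⟩, ⟨Z, g, w, h.2⟩⟩
      · rintro ⟨⟨Z, g, w, h⟩, h'⟩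
        exact ⟨Z, g, w, h, F.conf_of_deflation (E.shortExact h) h'⟩
    { conf := E.conf ⊓ F.conf
      shortExact := fun h => E.shortExact h.1
      of_iso := fun e h => ⟨E.of_iso e h.1, F.of_iso e h.2⟩
      id_inflation := fun X => (infl _).2 ⟨E.id_inflation X, F.id_inflation X⟩
      id_deflation := fun X => (defl _).2 ⟨E.id_deflation X, F.id_deflation X⟩
      comp_inflation := fun f g hf hg => (infl _).2
        ⟨E.comp_inflation f g ((infl _).1 hf).1 ((infl _).1 hg).1,
          F.comp_inflation f g ((infl _).1 hf).2 ((infl _).1 hg).2⟩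
      comp_deflation := fun f g hf hg => (defl _).2
        ⟨E.comp_deflation f g ((defl _).1 hf).1 ((defl _).1 hg).1,
          F.comp_deflation f g ((defl _).1 hf).2 ((defl _).1 hg).2⟩
      pushout_inflation := fun sq h => (infl _).2
        ⟨E.pushout_inflation sq ((infl _).1 h).1, F.pushout_inflation sq ((infl _).1 h).2⟩
      pullback_deflation := fun sq h => (defl _).2
        ⟨E.pullback_deflation sq ((defl _).1 h).1, F.pullback_deflation sq ((defl _).1 h).2⟩ }

lemma exists_pushout {A B X A' : C} {f : A ⟶ B} {g : B ⟶ X} {w : f ≫ g = 0}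
    (h : E.conf (ShortComplex.mk f g w)) (a : A ⟶ A') :
    ∃ (B' : C) (f' : A' ⟶ B') (g' : B' ⟶ X) (w' : f' ≫ g' = 0) (b : B ⟶ B'),
      E.conf (ShortComplex.mk f' g' w') ∧ f ≫ b = a ≫ f' ∧ b ≫ g' = g := by
  have hS := E.shortExact h
  obtain ⟨P, b, f', sq⟩ : ∃ (P : C) (b : B ⟶ P) (f' : A' ⟶ P), IsPushout f a b f' :=
    ⟨_, _, _, IsPushout.of_hasPushout f a⟩
  obtain ⟨g', hg₁, hg₂⟩ : ∃ g' : P ⟶ X, b ≫ g' = g ∧ f' ≫ g' = 0 :=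
    ⟨sq.desc g 0 (by rw [w, comp_zero]), sq.inl_desc .., sq.inr_desc ..⟩
  have hi : inflations E.conf f' := E.pushout_inflation sq ⟨X, g, w, h⟩
  refine ⟨P, f', g', hg₂, b, ?_, sq.w, hg₁⟩
  have h₁ : Epi g' := by
    have : Epi (b ≫ g') := by rw [hg₁]; exact hS.epi_g
    exact epi_of_epi b g'
  have h₂ : Mono f' := by
    obtain ⟨_, _, _, h'⟩ := hi
    exact (E.shortExact h').mono_f
  refine E.conf_of_inflation (.mk' ?_ h₂ h₁) hi
  refine ShortComplex.exact_of_g_is_cokernel _ (CokernelCofork.IsColimit.ofπ' _ _ fun {T} k hk => ?_)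
  have hk₀ : f' ≫ k = 0 := hk
  have hk' : f ≫ b ≫ k = 0 := by rw [← Category.assoc, sq.w, Category.assoc, hk₀, comp_zero]
  have : Epi (ShortComplex.mk f g w).g := hS.epi_g
  refine ⟨hS.exact.desc (b ≫ k) hk', ?_⟩
  have h₃ : g ≫ hS.exact.desc (b ≫ k) hk' = b ≫ k := hS.exact.g_desc _ _
  apply sq.hom_ext
  · exact (by rw [← Category.assoc, hg₁] : b ≫ g' ≫ _ = g ≫ _).trans h₃
  · rw [hk₀, ← Category.assoc, hg₂, zero_comp]

lemma exists_pullback {A B X X' : C} {f : A ⟶ B} {g : B ⟶ X} {w : f ≫ g = 0}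
    (h : E.conf (ShortComplex.mk f g w)) (x : X' ⟶ X) :
    ∃ (B' : C) (f' : A ⟶ B') (g' : B' ⟶ X') (w' : f' ≫ g' = 0) (b : B' ⟶ B),
      E.conf (ShortComplex.mk f' g' w') ∧ b ≫ g = g' ≫ x ∧ f' ≫ b = f := by
  have hS := E.shortExact h
  obtain ⟨P, b, g', sq⟩ : ∃ (P : C) (b : P ⟶ B) (g' : P ⟶ X'), IsPullback b g' g x :=
    ⟨_, _, _, IsPullback.of_hasPullback g x⟩
  obtain ⟨f', hf₁, hf₂⟩ : ∃ f' : A ⟶ P, f' ≫ b = f ∧ f' ≫ g' = 0 :=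
    ⟨sq.lift f 0 (by rw [w, zero_comp]), sq.lift_fst .., sq.lift_snd ..⟩
  have hi : deflations E.conf g' := E.pullback_deflation sq ⟨A, f, w, h⟩
  refine ⟨P, f', g', hf₂, b, ?_, sq.w, hf₁⟩
  have h₁ : Mono f' := by
    have : Mono (f' ≫ b) := by rw [hf₁]; exact hS.mono_f
    exact mono_of_mono f' b
  have h₂ : Epi g' := by
    obtain ⟨_, _, _, h'⟩ := hi
    exact (E.shortExact h').epi_g
  refine E.conf_of_deflation (.mk' ?_ h₁ h₂) hi
  refine ShortComplex.exact_of_f_is_kernel _ (KernelFork.IsLimit.ofι' _ _ fun {T} k hk => ?_)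
  have hk₀ : k ≫ g' = 0 := hk
  have hk' : (k ≫ b) ≫ g = 0 := by rw [Category.assoc, sq.w, ← Category.assoc, hk₀, zero_comp]
  have : Mono (ShortComplex.mk f g w).f := hS.mono_f
  refine ⟨hS.exact.lift (k ≫ b) hk', ?_⟩
  have h₃ : hS.exact.lift (k ≫ b) hk' ≫ f = k ≫ b := hS.exact.lift_f _ _
  apply sq.hom_ext
  · exact (by rw [Category.assoc, hf₁] : (_ ≫ f') ≫ b = _ ≫ f).trans h₃
  · rw [hk₀, Category.assoc, hf₂, comp_zero]

/-- The direct sum of two conflations is a conflation. -/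
lemma conf_biprod {A B X A' B' X' : C} {f : A ⟶ B} {g : B ⟶ X}
    {w : f ≫ g = 0} {f' : A' ⟶ B'} {g' : B' ⟶ X'} {w' : f' ≫ g' = 0}
    (h : E.conf (ShortComplex.mk f g w)) (h' : E.conf (ShortComplex.mk f' g' w')) :
    E.conf (ShortComplex.mk (biprod.map f f') (biprod.map g g')
      (by ext <;> simp [w, w'])) := by
  have hS := E.shortExact h
  have hS' := E.shortExact h'
  have e₁ : Epi g := hS.epi_g
  have e₂ : Epi g' := hS'.epi_g
  have m₁ : Mono f := hS.mono_f
  have m₂ : Mono f' := hS'.mono_f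
  apply E.conf_of_inflation
  · refine .mk' ?_ ?_ ?_
    · refine ShortComplex.exact_of_f_is_kernel _
        (KernelFork.IsLimit.ofι' _ _ fun {T} k hk => ?_)
      have hk₀ : k ≫ biprod.map g g' = 0 := hk
      have k₁ : (k ≫ biprod.fst) ≫ g = 0 := by
        have := hk₀ =≫ biprod.fst
        simpa using this
      have k₂ : (k ≫ biprod.snd) ≫ g' = 0 := by
        have := hk₀ =≫ biprod.snd
        simpa using this
      have l₁ : hS.exact.lift (k ≫ biprod.fst) k₁ ≫ f = _ := hS.exact.lift_f _ _
      have l₂ : hS'.exact.lift (k ≫ biprod.snd) k₂ ≫ f' = _ := hS'.exact.lift_f _ _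
      refine ⟨biprod.lift (hS.exact.lift (k ≫ biprod.fst) k₁)
        (hS'.exact.lift (k ≫ biprod.snd) k₂), ?_⟩
      apply biprod.hom_ext
      · simpa using l₁
      · simpa using l₂
    · dsimp; infer_instance
    · dsimp; infer_instance
  · have hf : inflations E.conf f := ⟨_, _, _, h⟩
    have hf' : inflations E.conf f' := ⟨_, _, _, h'⟩
    have s₁ : IsPushout f (biprod.inl : A ⟶ A ⊞ A') biprod.inl (biprod.map f (𝟙 A')) := by
      refine ⟨⟨by simp⟩, ⟨PushoutCocone.IsColimit.mk _
        (fun s => biprod.desc s.inl (biprod.inr ≫ s.inr)) ?_ ?_ ?_⟩⟩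
      · intro s; simp
      · intro s
        apply biprod.hom_ext'
        · simpa using s.condition
        · simp
      · intro s m h₁ h₂
        apply biprod.hom_ext'
        · simpa using h₁
        · simp [← h₂]
    have s₂ : IsPushout f' (biprod.inr : A' ⟶ B ⊞ A') biprod.inr (biprod.map (𝟙 B) f') := by
      refine ⟨⟨by simp⟩, ⟨PushoutCocone.IsColimit.mk _
        (fun s => biprod.desc (biprod.inl ≫ s.inr) s.inl) ?_ ?_ ?_⟩⟩
      · intro s; simp
      · intro s
        apply biprod.hom_ext'
        · simp
        · simpa using s.condition
      · intro s m h₁ h₂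
        apply biprod.hom_ext'
        · simp [← h₂]
        · simpa using h₁
    have := E.comp_inflation _ _ (E.pushout_inflation s₁ hf) (E.pushout_inflation s₂ hf')
    have he : biprod.map f (𝟙 A') ≫ biprod.map (𝟙 B) f' = biprod.map f f' := by
      ext <;> simp
    rwa [he] at this

section Ext

variable [HasExt.{w} C]

/-- A class in `Ext¹(X, A)` is realized by a conflation `A ⟶ B ⟶ X` of `E`. -/
def IsRealized {X A : C} (e : Ext X A 1) : Prop :=
  ∃ (B : C) (f : A ⟶ B) (g : B ⟶ X) (w : f ≫ g = 0) (h : E.conf (ShortComplex.mk f g w)),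
    (E.shortExact h).extClass = e

variable {E}

lemma IsRealized.postcomp {X A A' : C} {e : Ext X A 1} (he : E.IsRealized e) (a : A ⟶ A') :
    E.IsRealized (e.comp (Ext.mk₀ a) (add_zero 1)) := by
  obtain ⟨B, f, g, w, h, rfl⟩ := he
  obtain ⟨B', f', g', w', b, h', h₁, h₂⟩ := E.exists_pushout h a
  refine ⟨B', f', g', w', h', ?_⟩
  let φ : ShortComplex.mk f g w ⟶ ShortComplex.mk f' g' w' :=
    { τ₁ := a, τ₂ := b, τ₃ := 𝟙 X, comm₁₂ := h₁.symm, comm₂₃ := by simp [h₂] }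
  have := ShortComplex.ShortExact.extClass_naturality (E.shortExact h) (E.shortExact h') φ
  simp only [φ, Ext.mk₀_id_comp] at this
  exact this.symm

lemma IsRealized.precomp {X X' A : C} {e : Ext X A 1} (he : E.IsRealized e) (x : X' ⟶ X) :
    E.IsRealized ((Ext.mk₀ x).comp e (zero_add 1)) := by
  obtain ⟨B, f, g, w, h, rfl⟩ := he
  obtain ⟨B', f', g', w', b, h', h₁, h₂⟩ := E.exists_pullback h x
  refine ⟨B', f', g', w', h', ?_⟩
  let φ : ShortComplex.mk f' g' w' ⟶ ShortComplex.mk f g w :=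
    { τ₁ := 𝟙 A, τ₂ := b, τ₃ := x, comm₁₂ := by simp [h₂], comm₂₃ := h₁ }
  have := ShortComplex.ShortExact.extClass_naturality (E.shortExact h') (E.shortExact h) φ
  simp only [φ, Ext.comp_mk₀_id] at this
  exact this

variable (E) in
lemma isRealized_zero (X A : C) : E.IsRealized (0 : Ext X A 1) := by
  obtain ⟨B, g, w, h⟩ := E.id_inflation A
  have : E.IsRealized ((E.shortExact h).extClass) := ⟨_, _, _, _, h, rfl⟩
  simpa using this.precomp (0 : X ⟶ B)

lemma IsRealized.add {X A : C} {e e' : Ext X A 1} (he : E.IsRealized e) (he' : E.IsRealized e') :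
    E.IsRealized (e + e') := by
  obtain ⟨B, f, g, w, h, rfl⟩ := he
  obtain ⟨B', f', g', w', h', rfl⟩ := he'
  have hb := E.conf_biprod h h'
  have n₁ := ShortComplex.ShortExact.extClass_naturality (E.shortExact h) (E.shortExact hb)
    { τ₁ := biprod.inl, τ₂ := biprod.inl, τ₃ := biprod.inl }
  have n₂ := ShortComplex.ShortExact.extClass_naturality (E.shortExact h') (E.shortExact hb)
    { τ₁ := biprod.inr, τ₂ := biprod.inr, τ₃ := biprod.inr }
  have hr : E.IsRealized (E.shortExact hb).extClass := ⟨_, _, _, _, hb, rfl⟩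
  have := (hr.precomp (biprod.lift (𝟙 X) (𝟙 X))).postcomp (biprod.desc (𝟙 A) (𝟙 A))
  convert this using 1
  have hl : biprod.lift (𝟙 X) (𝟙 X) = (biprod.inl + biprod.inr : X ⟶ X ⊞ X) := by
    ext <;> simp
  dsimp at n₁ n₂
  rw [hl, Ext.mk₀_add, Ext.add_comp, ← n₁, ← n₂]
  simp

variable (R : Type*) [CommRing R] [Linear R C] (E)

/-- `Ext¹_E(X, A)`, the `R`-submodule of `Ext¹(X, A)` of the classes of the conflations
`A ⟶ B ⟶ X` of the exact structure `E`. -/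
def ext1 (X A : C) : Submodule R (Ext X A 1) where
  carrier := {e | E.IsRealized e}
  add_mem' := IsRealized.add
  zero_mem' := E.isRealized_zero X A
  smul_mem' r e he := by
    change E.IsRealized (r • e)
    rw [Ext.smul_eq_comp_mk₀]
    exact IsRealized.postcomp he _

/-- The map `Ext¹_E(X, f) : Ext¹_E(X, A) ⟶ Ext¹_E(X, A')` induced by `f : A ⟶ A'`. -/
noncomputable def ext1Map (X : C) {A A' : C} (f : A ⟶ A') : E.ext1 R X A →ₗ[R] E.ext1 R X A' :=
  ((Ext.mk₀ f).postcompOfLinear R X (add_zero 1)).restrict fun _ he => IsRealized.postcomp he f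

/-- For every conflation `A ⟶ B ⟶ Y` of `E` and every object `X`, the sequence
`Ext¹_E(X, A) ⟶ Ext¹_E(X, B) ⟶ Ext¹_E(X, Y) ⟶ 0` is exact. -/
def Ext1RightExact : Prop :=
  ∀ (S : ShortComplex C), E.conf S → ∀ X : C,
    Function.Exact (E.ext1Map R X S.f) (E.ext1Map R X S.g) ∧
      Function.Surjective (E.ext1Map R X S.g)

end Ext

/-- The `n`-extensions `A ⟶ B₁ ⟶ ⋯ ⟶ Bₙ ⟶ X` (for `n ≥ 1`) in the exact category `E`:
splicings of `n` conflations. -/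
inductive NExtension (E : ExactStructure C) : ℕ → C → C → Type (max u v)
  | single {A B X : C} (f : A ⟶ B) (g : B ⟶ X) (w : f ≫ g = 0)
      (h : E.conf (ShortComplex.mk f g w)) : NExtension E 1 X A
  | splice {n : ℕ} {A B K X : C} (f : A ⟶ B) (g : B ⟶ K) (w : f ≫ g = 0)
      (h : E.conf (ShortComplex.mk f g w)) (ε : NExtension E n X K) : NExtension E (n + 1) X A

/-- `NExtension.Hom ε ε' a x`: there is a morphism of complexes from `ε` to `ε'` which is `a` on
the left end and `x` on the right end. -/
inductive NExtension.Hom {E : ExactStructure C} : ∀ {n : ℕ} {A X A' X' : C},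
    NExtension E n X A → NExtension E n X' A' → (A ⟶ A') → (X ⟶ X') → Prop
  | single {A B X A' B' X' : C} {f : A ⟶ B} {g : B ⟶ X} {w : f ≫ g = 0}
      {h : E.conf (ShortComplex.mk f g w)} {f' : A' ⟶ B'} {g' : B' ⟶ X'} {w' : f' ≫ g' = 0}
      {h' : E.conf (ShortComplex.mk f' g' w')} (a : A ⟶ A') (b : B ⟶ B') (x : X ⟶ X')
      (comm₁ : f ≫ b = a ≫ f') (comm₂ : g ≫ x = b ≫ g') :
      NExtension.Hom (.single f g w h) (.single f' g' w' h') a x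
  | splice {n : ℕ} {A B K X A' B' K' X' : C} {f : A ⟶ B} {g : B ⟶ K} {w : f ≫ g = 0}
      {h : E.conf (ShortComplex.mk f g w)} {f' : A' ⟶ B'} {g' : B' ⟶ K'} {w' : f' ≫ g' = 0}
      {h' : E.conf (ShortComplex.mk f' g' w')}
      {ε : NExtension E n X K} {ε' : NExtension E n X' K'}
      (a : A ⟶ A') (b : B ⟶ B') (k : K ⟶ K') (x : X ⟶ X')
      (comm₁ : f ≫ b = a ≫ f') (comm₂ : g ≫ k = b ≫ g') (hε : NExtension.Hom ε ε' k x) :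
      NExtension.Hom (.splice f g w h ε) (.splice f' g' w' h' ε') a x

/-- Yoneda's `Extⁿ_E(X, A)` for `n ≥ 1` as a set: `n`-extensions modulo the equivalence relation
generated by the morphisms that are the identity on both ends. -/
def YonedaExt (E : ExactStructure C) (n : ℕ) (X A : C) : Type (max u v) :=
  Quot fun ε ε' : NExtension E n X A => NExtension.Hom ε ε' (𝟙 A) (𝟙 X)

/-- The exact category `E` has global dimension at most one: `Extⁿ_E(X, A) = 0`, i.e. the group
`Extⁿ_E(X, A)` has only one element, for all `n ≥ 2` and all `X`, `A`. -/
def IsHereditary (E : ExactStructure C) : Prop :=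
  ∀ n : ℕ, 2 ≤ n → ∀ X A : C, Subsingleton (E.YonedaExt n X A)

lemma shortExact_cokernel {X Y : C} (f : X ⟶ Y) [Mono f] :
    (ShortComplex.mk f (cokernel.π f) (cokernel.condition f)).ShortExact :=
  .mk' (ShortComplex.exact_cokernel f) inferInstance inferInstance

lemma shortExact_kernel {X Y : C} (g : X ⟶ Y) [Epi g] :
    (ShortComplex.mk (kernel.ι g) g (kernel.condition g)).ShortExact :=
  .mk' (ShortComplex.exact_kernel g) inferInstance inferInstance

lemma map_hom_shortExact_iff {S : ShortComplex C} (hS : S.ShortExact) (M : C) :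
    (S.op.map (preadditiveYoneda.obj M)).ShortExact ↔
      ∀ f : S.X₁ ⟶ M, ∃ g : S.X₂ ⟶ M, S.f ≫ g = f := by
  have e : (S.op.map (preadditiveYoneda.obj M)).Exact ∧
      Mono (S.op.map (preadditiveYoneda.obj M)).f := by
    have := ((Functor.preservesFiniteLimits_tfae (preadditiveYoneda.obj M)).out 0 3).2
      (inferInstance : PreservesFiniteLimits (preadditiveYoneda.obj M))
    exact this S.op hS.op
  constructor
  · intro h f
    have := (AddCommGrpCat.epi_iff_surjective _).1 h.epi_g
    exact this f
  · intro h
    refine .mk' e.1 e.2 ((AddCommGrpCat.epi_iff_surjective _).2 h)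

/-- For a class `U` of objects, the exact structure of all short exact sequences on which
`Hom(-, M)` is exact for all `M` in `U`. -/
def homExact (U : ObjectProperty C) : ExactStructure C :=
  let conf : ObjectProperty (ShortComplex C) := fun S =>
    S.ShortExact ∧ ∀ M, U M → (S.op.map (preadditiveYoneda.obj M)).ShortExact
  have hconf (S : ShortComplex C) : conf S ↔ S.ShortExact ∧ ∀ M, U M →
      ∀ f : S.X₁ ⟶ M, ∃ g : S.X₂ ⟶ M, S.f ≫ g = f :=
    and_congr_right fun hS => forall₂_congr fun M _ => map_hom_shortExact_iff hS M
  have infl {X Y : C} (f : X ⟶ Y) : inflations conf f ↔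
      Mono f ∧ ∀ M, U M → ∀ a : X ⟶ M, ∃ b : Y ⟶ M, f ≫ b = a := by
    constructor
    · rintro ⟨Z, g, w, h⟩
      exact ⟨h.1.mono_f, ((hconf _).1 h).2⟩
    · rintro ⟨h₁, h₂⟩
      exact ⟨_, _, _, (hconf _).2 ⟨shortExact_cokernel f, h₂⟩⟩
  have defl {X Y : C} (g : X ⟶ Y) : deflations conf g ↔
      Epi g ∧ ∀ (K : C) (k : K ⟶ X) (w : k ≫ g = 0), (ShortComplex.mk k g w).ShortExact →
        ∀ M, U M → ∀ a : K ⟶ M, ∃ b : X ⟶ M, k ≫ b = a := by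
    constructor
    · rintro ⟨K₀, k₀, w₀, h⟩
      refine ⟨h.1.epi_g, fun K k w hk M hM a => ?_⟩
      have : Mono k₀ := h.1.mono_f
      have : Mono (ShortComplex.mk k g w).f := hk.mono_f
      obtain ⟨b, hb⟩ := ((hconf _).1 h).2 M hM (hk.exact.lift k₀ w₀ ≫ a)
      have hl : hk.exact.lift k₀ w₀ ≫ k = k₀ := hk.exact.lift_f _ _
      have : Mono (ShortComplex.mk k₀ g w₀).f := h.1.mono_f
      have hl' : h.1.exact.lift k w ≫ k₀ = k := h.1.exact.lift_f _ _
      have hi : h.1.exact.lift k w ≫ hk.exact.lift k₀ w₀ = 𝟙 K := by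
        have : Mono k := hk.mono_f
        rw [← cancel_mono k, Category.assoc, hl, hl', Category.id_comp]
      refine ⟨b, ?_⟩
      have hb' : k₀ ≫ b = hk.exact.lift k₀ w₀ ≫ a := hb
      rw [← hl', Category.assoc, hb', ← Category.assoc, hi, Category.id_comp]
    · rintro ⟨h₁, h₂⟩
      exact ⟨_, _, _, (hconf _).2 ⟨shortExact_kernel g, h₂ _ _ _ (shortExact_kernel g)⟩⟩
  { conf := conf
    shortExact := fun h => h.1
    of_iso := by
      intro S T e h
      rw [hconf] at h ⊢
      refine ⟨(ShortComplex.shortExact_iff_of_iso e).1 h.1, fun M hM f => ?_⟩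
      obtain ⟨g, hg⟩ := h.2 M hM (e.hom.τ₁ ≫ f)
      refine ⟨e.inv.τ₂ ≫ g, ?_⟩
      rw [← Category.assoc, ← e.inv.comm₁₂, Category.assoc, hg, ← Category.assoc,
        ← ShortComplex.comp_τ₁, e.inv_hom_id, ShortComplex.id_τ₁, Category.id_comp]
    id_inflation := fun X => (infl _).2 ⟨inferInstance, fun M _ a => ⟨a, Category.id_comp a⟩⟩
    id_deflation := fun X => (defl _).2 ⟨inferInstance, fun K k w hk M _ a => by
      have : Mono k := hk.mono_f
      refine ⟨0, ?_⟩
      have hk0 : k = 0 := by simpa using w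
      have : 𝟙 K = 0 := by rw [← cancel_mono k, hk0, comp_zero, comp_zero]
      rw [comp_zero, ← Category.id_comp a, this, zero_comp]⟩
    comp_inflation := by
      intro X Y Z f g hf hg
      rw [infl] at hf hg ⊢
      have := hf.1
      have := hg.1
      refine ⟨mono_comp f g, fun M hM a => ?_⟩
      obtain ⟨b, rfl⟩ := hf.2 M hM a
      obtain ⟨c, rfl⟩ := hg.2 M hM b
      exact ⟨c, Category.assoc _ _ _⟩
    comp_deflation := by
      intro X Y Z p q hp hq
      rw [defl] at hp hq ⊢
      have := hp.1
      have := hq.1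
      refine ⟨epi_comp p q, fun K k w hk M hM a => ?_⟩
      have : Mono k := hk.mono_f
      have : Mono (ShortComplex.mk k (p ≫ q) w).f := hk.mono_f
      let i : kernel p ⟶ K := hk.exact.lift (kernel.ι p) (by simp)
      have hi : i ≫ k = kernel.ι p := hk.exact.lift_f _ _
      obtain ⟨b, hb⟩ := hp.2 _ _ _ (shortExact_kernel p) M hM (i ≫ a)
      -- the map from `K` to `kernel q` is the pullback of `p`, hence a cokernel of `i`
      let r : K ⟶ kernel q := kernel.lift q (k ≫ p) (by simpa using w)
      have hr : r ≫ kernel.ι q = k ≫ p := kernel.lift_ι _ _ _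
      have sq : IsPullback k r p (kernel.ι q) := by
        refine ⟨⟨hr.symm⟩, ⟨PullbackCone.IsLimit.mk _
          (fun s => hk.exact.lift s.fst (by
            change s.fst ≫ p ≫ q = 0
            rw [← Category.assoc, s.condition, Category.assoc, kernel.condition, comp_zero]))
          (fun s => hk.exact.lift_f _ _) (fun s => ?_) (fun s m h₁ h₂ => ?_)⟩⟩
        · rw [← cancel_mono (kernel.ι q), Category.assoc, hr, ← Category.assoc]
          exact (congrArg (· ≫ p) (hk.exact.lift_f _ _)).trans s.condition
        · rw [← cancel_mono k, h₁]
          exact (hk.exact.lift_f _ _).symm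
      have hre : Epi r := (MorphismProperty.epimorphisms C).of_isPullback sq
        (MorphismProperty.epimorphisms.infer_property p)
      have hir : i ≫ r = 0 := by
        rw [← cancel_mono (kernel.ι q), Category.assoc, hr, ← Category.assoc, hi,
          kernel.condition, zero_comp]
      have hex : (ShortComplex.mk i r hir).ShortExact := by
        have : Mono i := by
          have : Mono (i ≫ k) := by rw [hi]; infer_instance
          exact mono_of_mono i k
        refine .mk' ?_ this hre
        refine ShortComplex.exact_of_f_is_kernel _
          (KernelFork.IsLimit.ofι' _ _ fun {T} t ht => ?_)
        have ht₀ : t ≫ r = 0 := ht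
        refine ⟨kernel.lift p (t ≫ k) ?_, ?_⟩
        · rw [Category.assoc, ← hr, ← Category.assoc, ht₀, zero_comp]
        · change _ ≫ i = t
          rw [← cancel_mono k, Category.assoc, hi, kernel.lift_ι]
      have hc : i ≫ (a - k ≫ b) = 0 := by
        rw [Preadditive.comp_sub, ← Category.assoc, hi, hb, sub_self]
      have : Epi (ShortComplex.mk i r hir).g := hre
      obtain ⟨c, hc'⟩ := hq.2 _ _ _ (shortExact_kernel q) M hM (hex.exact.desc (a - k ≫ b) hc)
      have hd : r ≫ hex.exact.desc (a - k ≫ b) hc = a - k ≫ b := hex.exact.g_desc _ _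
      refine ⟨b + p ≫ c, ?_⟩
      rw [Preadditive.comp_add, ← Category.assoc, ← hr, Category.assoc, hc', hd,
        add_sub_cancel]
    pushout_inflation := by
      intro A B A' B' f a b f' sq h
      rw [infl] at h ⊢
      refine ⟨(MorphismProperty.monomorphisms C).of_isPushout sq.flip h.1, fun M hM x => ?_⟩
      obtain ⟨y, hy⟩ := h.2 M hM (a ≫ x)
      exact ⟨sq.desc y x hy, sq.inr_desc _ _ _⟩
    pullback_deflation := by
      intro B X B' X' g b x g' sq h
      rw [defl] at h ⊢
      have := h.1
      refine ⟨(MorphismProperty.epimorphisms C).of_isPullback sq h.1, fun K k w hk M hM y => ?_⟩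
      have : Mono k := hk.mono_f
      have : Mono (ShortComplex.mk k g' w).f := hk.mono_f
      have w' : (k ≫ b) ≫ g = 0 := by rw [Category.assoc, sq.w, ← Category.assoc, w, zero_comp]
      have hm : Mono (k ≫ b) := by
        refine Preadditive.mono_of_cancel_zero _ fun {T} t ht => ?_
        rw [← cancel_mono k, zero_comp]
        apply sq.hom_ext
        · rw [Category.assoc, ht, zero_comp]
        · rw [Category.assoc, w, comp_zero, zero_comp]
      have hex : (ShortComplex.mk (k ≫ b) g w').ShortExact := by
        refine .mk' ?_ hm h.1
        refine ShortComplex.exact_of_f_is_kernel _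
          (KernelFork.IsLimit.ofι' _ _ fun {T} t ht => ?_)
        have ht₀ : t ≫ g = 0 := ht
        have hl : hk.exact.lift (sq.lift t 0 (by rw [ht₀, zero_comp])) (sq.lift_snd _ _ _) ≫ k = _ :=
          hk.exact.lift_f _ _
        refine ⟨hk.exact.lift (sq.lift t 0 (by rw [ht₀, zero_comp])) (sq.lift_snd _ _ _), ?_⟩
        change _ ≫ k ≫ b = t
        rw [← Category.assoc, hl, sq.lift_fst]
      obtain ⟨z, hz⟩ := h.2 _ _ _ hex M hM y
      exact ⟨b ≫ z, by rw [← Category.assoc, hz]⟩ }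

lemma map_left_exact {D' : Type*} [Category* D'] [Abelian D'] (F : C ⥤ D') [F.Additive]
    [PreservesFiniteLimits F] {S : ShortComplex C} (hS : S.ShortExact) :
    (S.map F).Exact ∧ Mono (F.map S.f) := by
  have := ((Functor.preservesFiniteLimits_tfae F).out 0 3).2 ‹PreservesFiniteLimits F›
  exact this S hS

lemma map_shortExact_iff {D' : Type*} [Category* D'] [Abelian D'] (F : C ⥤ D') [F.Additive]
    [PreservesFiniteLimits F] {S : ShortComplex C} (hS : S.ShortExact) :
    (S.map F).ShortExact ↔ Epi (F.map S.g) := by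
  have e : (S.map F).Exact ∧ Mono (S.map F).f :=
    map_left_exact F hS
  exact ⟨fun h => h.epi_g, fun h => .mk' e.1 e.2 h⟩

/-- For a left exact functor `F`, the exact structure of all short exact sequences whose image
under `F` is a short exact sequence. -/
def functorExact {D' : Type*} [Category* D'] [Abelian D'] (F : C ⥤ D') [F.Additive]
    [PreservesFiniteLimits F] : ExactStructure C :=
  let conf : ObjectProperty (ShortComplex C) := fun S => S.ShortExact ∧ (S.map F).ShortExact
  have hconf (S : ShortComplex C) : conf S ↔ S.ShortExact ∧ Epi (F.map S.g) :=
    and_congr_right fun hS => map_shortExact_iff F hS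
  have infl {X Y : C} (f : X ⟶ Y) : inflations conf f ↔ Mono f ∧
      ∀ (Z : C) (g : Y ⟶ Z) (w : f ≫ g = 0), (ShortComplex.mk f g w).ShortExact →
        Epi (F.map g) := by
    constructor
    · rintro ⟨Z₀, g₀, w₀, h⟩
      refine ⟨h.1.mono_f, fun Z g w hg => ?_⟩
      have h₁ := hg.epi_g
      have : Epi (F.map g₀) := ((hconf _).1 h).2
      have : Epi (ShortComplex.mk f g₀ w₀).g := h.1.epi_g
      have : Epi (ShortComplex.mk f g w).g := h₁
      have hd : g₀ ≫ h.1.exact.desc g w = g := h.1.exact.g_desc _ _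
      have hd' : g ≫ hg.exact.desc g₀ w₀ = g₀ := hg.exact.g_desc _ _
      have hi : hg.exact.desc g₀ w₀ ≫ h.1.exact.desc g w = 𝟙 Z := by
        have : Epi g := h₁
        rw [← cancel_epi g, ← Category.assoc, hd', hd, Category.comp_id]
      have : IsSplitEpi (h.1.exact.desc g w) := ⟨⟨_, hi⟩⟩
      rw [← hd, F.map_comp]
      infer_instance
    · rintro ⟨h₁, h₂⟩
      exact ⟨_, _, _, (hconf _).2 ⟨shortExact_cokernel f, h₂ _ _ _ (shortExact_cokernel f)⟩⟩
  have defl {X Y : C} (g : X ⟶ Y) : deflations conf g ↔ Epi g ∧ Epi (F.map g) := by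
    constructor
    · rintro ⟨Z, f, w, h⟩
      exact ⟨h.1.epi_g, ((hconf _).1 h).2⟩
    · rintro ⟨h₁, h₂⟩
      exact ⟨_, _, _, (hconf _).2 ⟨shortExact_kernel g, h₂⟩⟩
  { conf := conf
    shortExact := fun h => h.1
    of_iso := by
      intro S T e h
      exact ⟨(ShortComplex.shortExact_iff_of_iso e).1 h.1,
        (ShortComplex.shortExact_iff_of_iso (F.mapShortComplex.mapIso e)).1 h.2⟩
    id_inflation := fun X => (infl _).2 ⟨inferInstance, fun Z g w hg => by
      have hg0 : g = 0 := by simpa using w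
      have : Epi g := hg.epi_g
      have hz : 𝟙 Z = 0 := by rw [← cancel_epi g, hg0, zero_comp, zero_comp]
      have : IsSplitEpi g := ⟨⟨0, by rw [zero_comp, hz]⟩⟩
      infer_instance⟩
    id_deflation := fun X => (defl _).2 ⟨inferInstance, inferInstance⟩
    comp_inflation := by
      intro X Y Z f f' hf hf'
      rw [infl] at hf hf' ⊢
      have := hf.1
      have := hf'.1
      refine ⟨mono_comp f f', fun D d w hd => ?_⟩
      have hde : Epi d := hd.epi_g
      have : Epi (ShortComplex.mk (f ≫ f') d w).g := hde
      have hc := shortExact_cokernel f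
      have hc' := shortExact_cokernel f'
      have he := hf.2 _ _ _ hc
      have he' := hf'.2 _ _ _ hc'
      let i : cokernel f ⟶ D := cokernel.desc f (f' ≫ d) (by simpa using w)
      have hi : cokernel.π f ≫ i = f' ≫ d := cokernel.π_desc _ _ _
      let r : D ⟶ cokernel f' := hd.exact.desc (cokernel.π f') (by simp)
      have hr : d ≫ r = cokernel.π f' := hd.exact.g_desc _ _
      have hir : i ≫ r = 0 := by
        rw [← cancel_epi (cokernel.π f), ← Category.assoc, hi, Category.assoc, hr,
          cokernel.condition, comp_zero]
      have hex : (ShortComplex.mk i r hir).ShortExact := by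
        have hre : Epi r := by
          have : Epi (d ≫ r) := by rw [hr]; infer_instance
          exact epi_of_epi d r
        have hex : (ShortComplex.mk i r hir).Exact := by
          refine ShortComplex.exact_of_g_is_cokernel _
            (CokernelCofork.IsColimit.ofπ' _ _ fun {T} t ht => ?_)
          have ht₀ : i ≫ t = 0 := ht
          refine ⟨cokernel.desc f' (d ≫ t) ?_, ?_⟩
          · rw [← Category.assoc, ← hi, Category.assoc, ht₀, comp_zero]
          · change r ≫ _ = t
            rw [← cancel_epi d, ← Category.assoc, hr, cokernel.π_desc]
        refine .mk' hex ?_ hre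
        refine Preadditive.mono_of_cancel_zero _ fun {T} t ht => ?_
        have ht₀ : t ≫ i = 0 := ht
        obtain ⟨T', π, hπ, y, hy⟩ := surjective_up_to_refinements_of_epi (cokernel.π f) t
        have h0 : (y ≫ f') ≫ d = 0 := by
          rw [Category.assoc, ← hi, ← Category.assoc, ← hy, Category.assoc, ht₀, comp_zero]
        have : Mono (ShortComplex.mk (f ≫ f') d w).f := hd.mono_f
        have hl : hd.exact.lift (y ≫ f') h0 ≫ f ≫ f' = y ≫ f' := hd.exact.lift_f _ _
        have hl' : hd.exact.lift (y ≫ f') h0 ≫ f = y := by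
          rw [← cancel_mono f', Category.assoc, hl]
        rw [← cancel_epi π, hy, ← hl', Category.assoc, cokernel.condition, comp_zero, comp_zero]
      have hF : (ShortComplex.mk i r hir |>.map F).Exact :=
        (map_left_exact F hex).1
      rw [epi_iff_surjective_up_to_refinements]
      intro A y
      obtain ⟨A₁, π₁, _, z, hz⟩ :=
        surjective_up_to_refinements_of_epi (F.map (cokernel.π f')) (y ≫ F.map r)
      have h0 : (π₁ ≫ y - z ≫ F.map d) ≫ F.map r = 0 := by
        rw [Preadditive.sub_comp, Category.assoc, Category.assoc, hz, ← F.map_comp, hr, sub_self]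
      obtain ⟨A₂, π₂, _, t, ht₀⟩ : ∃ (A₂ : D') (π₂ : A₂ ⟶ A₁) (_ : Epi π₂)
          (t : A₂ ⟶ F.obj (cokernel f)), π₂ ≫ (π₁ ≫ y - z ≫ F.map d) = t ≫ F.map i :=
        hF.exact_up_to_refinements _ h0
      obtain ⟨A₃, π₃, _, s, hs⟩ :=
        surjective_up_to_refinements_of_epi (F.map (cokernel.π f)) t
      refine ⟨A₃, π₃ ≫ π₂ ≫ π₁, inferInstance, π₃ ≫ π₂ ≫ z + s ≫ F.map f', ?_⟩
      have h₄ : π₃ ≫ π₂ ≫ (π₁ ≫ y - z ≫ F.map d) = s ≫ F.map f' ≫ F.map d := by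
        rw [ht₀, ← Category.assoc, hs, Category.assoc, ← F.map_comp, hi, F.map_comp]
      simp only [Preadditive.comp_sub] at h₄
      simp only [Preadditive.add_comp, Category.assoc]
      rw [← h₄]
      abel
    comp_deflation := by
      intro X Y Z f g hf hg
      rw [defl] at hf hg ⊢
      obtain ⟨_, _⟩ := hf
      obtain ⟨_, _⟩ := hg
      rw [F.map_comp]
      exact ⟨epi_comp _ _, epi_comp _ _⟩
    pushout_inflation := by
      intro A B A' B' f a b f' sq h
      rw [infl] at h ⊢
      refine ⟨(MorphismProperty.monomorphisms C).of_isPushout sq.flip h.1, fun Z g w hg => ?_⟩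
      have hf := h.1
      have hge : Epi g := hg.epi_g
      have : Epi (ShortComplex.mk f' g w).g := hge
      have w' : f ≫ b ≫ g = 0 := by rw [← Category.assoc, sq.w, Category.assoc, w, comp_zero]
      have he : Epi (b ≫ g) := by
        refine Preadditive.epi_of_cancel_zero _ fun {T} t ht => ?_
        rw [← cancel_epi g, comp_zero]
        apply sq.hom_ext
        · rw [← Category.assoc, ht, comp_zero]
        · rw [← Category.assoc, w, zero_comp, comp_zero]
      have hex : (ShortComplex.mk f (b ≫ g) w').ShortExact := by
        refine .mk' ?_ hf he
        refine ShortComplex.exact_of_g_is_cokernel _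
          (CokernelCofork.IsColimit.ofπ' _ _ fun {T} t ht => ?_)
        have ht₀ : f ≫ t = 0 := ht
        have hl : g ≫ hg.exact.desc (sq.desc t 0 (by rw [ht₀, comp_zero])) (sq.inr_desc _ _ _) = _ :=
          hg.exact.g_desc _ _
        refine ⟨hg.exact.desc (sq.desc t 0 (by rw [ht₀, comp_zero])) (sq.inr_desc _ _ _), ?_⟩
        change (b ≫ g) ≫ _ = t
        rw [Category.assoc, hl, sq.inl_desc]
      have := h.2 _ _ _ hex
      rw [F.map_comp] at this
      exact epi_of_epi (F.map b) (F.map g)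
    pullback_deflation := by
      intro B X B' X' g b x g' sq h
      rw [defl] at h ⊢
      exact ⟨(MorphismProperty.epimorphisms C).of_isPullback sq h.1,
        (MorphismProperty.epimorphisms D').of_isPullback (sq.map F) h.2⟩ }

end ExactStructure

end General

section Modules

variable (R : Type u) [CommRing R]

/-- The submodule `radⁿ M = Pⁿ M` of a module `M` over the local ring `R` with maximal
ideal `P`. -/
def rad [IsLocalRing R] (n : ℕ) (M : Type*) [AddCommGroup M] [Module R M] : Submodule R M :=
  IsLocalRing.maximalIdeal R ^ n • (⊤ : Submodule R M)

variable [IsNoetherianRing R]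

noncomputable instance : HasExt.{u + 1} (FGModuleCat.{u} R) := HasExt.standard _

/-- `radⁿ` as a functor on finitely generated modules. -/
def radFunctor [IsLocalRing R] (n : ℕ) : FGModuleCat.{u} R ⥤ FGModuleCat.{u} R where
  obj M := FGModuleCat.of R (rad R n M)
  map {M N} f := FGModuleCat.ofHom (f.hom.hom.restrict fun x hx => by
    have : (rad R n M).map f.hom.hom ≤ rad R n N := by
      unfold rad
      rw [Submodule.map_smul'']
      exact Submodule.smul_mono le_rfl le_top
    exact this ⟨x, hx, rfl⟩)

lemma exact_iff (S : ShortComplex (FGModuleCat.{u} R)) :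
    S.Exact ↔ ∀ y : S.X₂, S.g.hom.hom y = 0 → ∃ x : S.X₁, S.f.hom.hom x = y := by
  rw [← ShortComplex.exact_map_iff_of_faithful S (forget₂ (FGModuleCat.{u} R) (ModuleCat.{u} R)),
    ShortComplex.moduleCat_exact_iff]
  rfl

lemma mono_iff {M N : FGModuleCat.{u} R} (f : M ⟶ N) :
    Mono f ↔ Function.Injective f.hom.hom := by
  rw [← Functor.mono_map_iff_mono (forget₂ (FGModuleCat.{u} R) (ModuleCat.{u} R)),
    ModuleCat.mono_iff_injective]
  rfl

variable [IsDomain R]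

/-- The functor sending a finitely generated module to its torsion submodule. -/
def torsionFunctor : FGModuleCat.{u} R ⥤ FGModuleCat.{u} R where
  obj M := FGModuleCat.of R (Submodule.torsion R M)
  map f := FGModuleCat.ofHom (f.hom.hom.restrict fun x hx => by
    obtain ⟨a, ha⟩ := hx
    exact ⟨a, by rw [← LinearMap.map_smul_of_tower, ha, map_zero]⟩)

instance : (torsionFunctor R).Additive where

instance : PreservesFiniteLimits (torsionFunctor R) := by
  refine ((Functor.preservesFiniteLimits_tfae (torsionFunctor R)).out 0 3).1 fun S hS => ?_
  have hf := (mono_iff R S.f).1 hS.mono_f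
  refine ⟨(exact_iff R _).2 ?_, (mono_iff R _).2 fun x y h => ?_⟩
  · rintro (y : Submodule.torsion R S.X₂) hy
    obtain ⟨a, ha⟩ := y
    obtain ⟨x, hx⟩ := (exact_iff R S).1 hS.exact a (congrArg Subtype.val hy)
    obtain ⟨r, hr⟩ := ha
    refine ⟨⟨x, r, hf ?_⟩, Subtype.ext hx⟩
    rw [LinearMap.map_smul_of_tower, hx, hr, map_zero]
  · exact Subtype.ext (hf (congrArg Subtype.val h))

variable [IsDiscreteValuationRing R]

/-- The modules `R/P^ℓ` for `ℓ ∈ L`, where `P` is the maximal ideal of `R`. -/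
def cyclicModules (L : Set ℕ) : ObjectProperty (FGModuleCat.{u} R) :=
  fun M => ∃ ℓ ∈ L, M = FGModuleCat.of R (R ⧸ IsLocalRing.maximalIdeal R ^ ℓ)

/-- The exact structure `E_L` on finitely generated modules: short exact sequences on which
`Hom(-, R/P^ℓ)` is exact for all `ℓ ∈ L`. -/
def homExactStructure (L : Set ℕ) : ExactStructure (FGModuleCat.{u} R) :=
  ExactStructure.homExact (cyclicModules R L)

/-- The exact structure `E'` on finitely generated modules: short exact sequences on which the
torsion functor is exact. -/
def torsionExactStructure : ExactStructure (FGModuleCat.{u} R) :=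
  ExactStructure.functorExact (torsionFunctor R)

/-- The exact structure `E'_L` on finitely generated modules: short exact sequences on which the
torsion functor and all `Hom(-, R/P^ℓ)`, `ℓ ∈ L`, are exact. -/
def homTorsionExactStructure (L : Set ℕ) : ExactStructure (FGModuleCat.{u} R) :=
  homExactStructure R L ⊓ torsionExactStructure R

end Modules

end RelExt

/-! All the exact structures involved have the form "Hom(-, M) is exact for every M in U"
(`ExactStructure.homExact`). For E_L this is the definition. For E', U consists of R alone
(`torsionExactStructureEq` is not needed beyond this identification, which is
`torsionExactStructure_eq_homExact`). By the long exact sequence, a class e in Ext¹(X, Y) is then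
relative exactly when f_* e = 0 for all f : Y → M with M in U (`mem_ext1_homExact_iff`).

Let ϖ generate P. Since ϖⁿ kills R/P^ℓ for ℓ ≤ n, multiples of ϖⁿ are relative for E_L. Conversely,
Y/ϖⁿY is a direct sum of modules R/P^ℓ with ℓ ≤ n, so a relative class e dies in Ext¹(X, Y/ϖⁿY) and
comes from the submodule ϖⁿY. As Ext² = 0, it lifts further along Y → ϖⁿY, so e = ϖⁿ e'. For E',
split Y into torsion plus free: Ext¹_{E'}(X, Y) is the image of Ext¹(X, Y_tors), and the projection
onto it commutes with ϖⁿ.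

In the relative sequences, middle exactness holds for every U, because maps A → M extend to B.
Surjectivity follows from (1): write e = ϖⁿ e', lift e' using Ext² = 0, and multiply the lift by ϖⁿ.
For E'_L the lift is made between torsion submodules.

Right exactness of relative Ext¹ gives heredity: for an extension beginning A → B → K, the part
ending in K lifts along B → K to an extension δ of X by B. Splicing A → A ⊕ B → B with δ then maps
both to the given extension and to the trivial one. -/

open ZeroObject

namespace RelExt

/-! ### Extension classes of short exact sequences -/

section ShortExact

variable {C : Type u} [Category.{v} C] [Abelian C] [HasExt.{w} C]

lemma extClass_comp_mk₀_eq_zero_iff {S : ShortComplex C} (hS : S.ShortExact) {M : C}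
    (f : S.X₁ ⟶ M) :
    hS.extClass.comp (Ext.mk₀ f) (add_zero 1) = 0 ↔ ∃ g : S.X₂ ⟶ M, S.f ≫ g = f := by
  constructor
  · intro h
    obtain ⟨x, hx⟩ := Ext.contravariant_sequence_exact₁ hS M (Ext.mk₀ f) (add_zero 1) h
    obtain ⟨g, rfl⟩ := Ext.homEquiv₀.symm.surjective x
    refine ⟨g, Ext.homEquiv₀.symm.injective ?_⟩
    simpa using hx
  · rintro ⟨g, rfl⟩
    rw [← Ext.mk₀_comp_mk₀]
    exact hS.extClass_comp_assoc _

lemma mk₀_comp_extClass_eq_zero_iff {S : ShortComplex C} (hS : S.ShortExact) {X : C}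
    (x : X ⟶ S.X₃) :
    (Ext.mk₀ x).comp hS.extClass (zero_add 1) = 0 ↔ ∃ y : X ⟶ S.X₂, y ≫ S.g = x := by
  constructor
  · intro h
    obtain ⟨y, hy⟩ := Ext.covariant_sequence_exact₃ X hS (Ext.mk₀ x) (zero_add 1) h
    obtain ⟨g, rfl⟩ := Ext.homEquiv₀.symm.surjective y
    exact ⟨g, Ext.homEquiv₀.symm.injective (by simpa using hy)⟩
  · rintro ⟨y, rfl⟩
    rw [← Ext.mk₀_comp_mk₀_assoc, hS.comp_extClass, Ext.comp_zero]

/-- Maps on the ends of two short exact sequences that are compatible with the extension classes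
extend to a morphism of short exact sequences. -/
lemma exists_hom_of_extClass_comp_eq {S T : ShortComplex C} (hS : S.ShortExact)
    (hT : T.ShortExact) (a : S.X₁ ⟶ T.X₁) (x : S.X₃ ⟶ T.X₃)
    (h : hS.extClass.comp (Ext.mk₀ a) (add_zero 1) =
      (Ext.mk₀ x).comp hT.extClass (zero_add 1)) :
    ∃ b : S.X₂ ⟶ T.X₂, S.f ≫ b = a ≫ T.f ∧ b ≫ T.g = S.g ≫ x := by
  have : Epi S.g := hS.epi_g
  obtain ⟨b, hb⟩ := (extClass_comp_mk₀_eq_zero_iff hS (a ≫ T.f)).1 (by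
    rw [← Ext.mk₀_comp_mk₀, ← Ext.comp_assoc _ _ _ (add_zero 1) (add_zero 0) (by lia), h,
      Ext.comp_assoc _ _ _ (zero_add 1) (add_zero 1) (by lia), hT.extClass_comp, Ext.comp_zero])
  have w : S.f ≫ b ≫ T.g = 0 := by
    rw [← Category.assoc, hb, Category.assoc, T.zero, comp_zero]
  have hu : S.g ≫ hS.exact.desc (b ≫ T.g) w = b ≫ T.g := hS.exact.g_desc _ _
  set u := hS.exact.desc (b ≫ T.g) w
  have hn := hS.extClass_naturality hT
    { τ₁ := a, τ₂ := b, τ₃ := u, comm₁₂ := hb.symm, comm₂₃ := hu.symm }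
  -- The map `u` induced by `b` on the right ends need not be `x`, but both pull the class of `T`
  -- back to the same class. Hence `u - x` lifts to `v`, and `b` is corrected by `S.g ≫ v`, which
  -- vanishes on `S.X₁`.
  obtain ⟨v, hv⟩ := (mk₀_comp_extClass_eq_zero_iff hT (u - x)).1 (by
    rw [sub_eq_add_neg, Ext.mk₀_add, Ext.mk₀_neg, Ext.add_comp, Ext.neg_comp, ← h, hn,
      add_neg_cancel])
  refine ⟨b - S.g ≫ v, ?_, ?_⟩
  · rw [Preadditive.comp_sub, hb, ← Category.assoc, S.zero, zero_comp, sub_zero]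
  · rw [Preadditive.sub_comp, Category.assoc, hv, Preadditive.comp_sub, hu, sub_sub_cancel]

end ShortExact

namespace ExactStructure

/-! ### Exact structures defined by exactness of Hom(-, M) -/

section HomExact

variable {C : Type u} [Category.{v} C] [Abelian C]

lemma homExact_conf_iff (U : ObjectProperty C) (S : ShortComplex C) :
    (homExact U).conf S ↔ S.ShortExact ∧ ∀ M, U M →
      ∀ f : S.X₁ ⟶ M, ∃ g : S.X₂ ⟶ M, S.f ≫ g = f :=
  and_congr_right fun hS => forall₂_congr fun M _ => map_hom_shortExact_iff hS M

lemma homExact_inf (U V : ObjectProperty C) : homExact U ⊓ homExact V = homExact (U ⊔ V) := by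
  refine ExactStructure.ext (funext fun S => propext ?_)
  change (homExact U).conf S ∧ (homExact V).conf S ↔ _
  simp only [homExact_conf_iff]
  constructor
  · rintro ⟨⟨hS, h₁⟩, _, h₂⟩
    exact ⟨hS, fun M hM => hM.elim (h₁ M) (h₂ M)⟩
  · rintro ⟨hS, h⟩
    exact ⟨⟨hS, fun M hM => h M (Or.inl hM)⟩, hS, fun M hM => h M (Or.inr hM)⟩

variable [HasExt.{w} C]

/-- For empty U every short exact sequence is a conflation. Dimension shifting makes each class a
pushout of the sequence of a projective presentation of `X`, and conflations are stable under
pushout. -/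
lemma isRealized_homExact_bot [EnoughProjectives C] {X A : C} (e : Ext X A 1) :
    (homExact (⊥ : ObjectProperty C)).IsRealized e := by
  have hS := shortExact_kernel (Projective.π X)
  have hc : (homExact (⊥ : ObjectProperty C)).conf _ :=
    (homExact_conf_iff _ _).2 ⟨hS, fun _ h => h.elim⟩
  obtain ⟨x, rfl⟩ := Ext.contravariant_sequence_exact₃ hS A e
    (Ext.eq_zero_of_projective _) (add_zero 1)
  obtain ⟨f, rfl⟩ := Ext.homEquiv₀.symm.surjective x
  exact IsRealized.postcomp ⟨_, _, _, _, hc, rfl⟩ f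

variable (R : Type*) [CommRing R] [Linear R C]

/-- A map A → M extends to the middle term exactly when it pushes the extension class to zero. Thus
membership becomes a vanishing condition on the class alone, independent of the sequence chosen to
realize it. -/
lemma mem_ext1_homExact_iff [EnoughProjectives C] (U : ObjectProperty C) {X A : C}
    (e : Ext X A 1) :
    e ∈ (homExact U).ext1 R X A ↔
      ∀ M, U M → ∀ f : A ⟶ M, e.comp (Ext.mk₀ f) (add_zero 1) = 0 := by
  constructor
  · intro he M hM a
    obtain ⟨B, f, g, w, h, rfl⟩ : (homExact U).IsRealized e := he
    exact (extClass_comp_mk₀_eq_zero_iff ((homExact U).shortExact h) a).2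
      (((homExact_conf_iff U (ShortComplex.mk f g w)).1 h).2 M hM a)
  · intro h
    obtain ⟨B, f, g, w, hc, rfl⟩ := isRealized_homExact_bot e
    have hS := (homExact _).shortExact hc
    have hc' : (homExact U).conf (ShortComplex.mk f g w) := (homExact_conf_iff U _).2
      ⟨hS, fun M hM a => (extClass_comp_mk₀_eq_zero_iff hS a).1 (h M hM a)⟩
    exact (⟨B, f, g, w, hc', rfl⟩ : (homExact U).IsRealized _)

lemma ext1Map_coe (E : ExactStructure C) {X A A' : C} (f : A ⟶ A') (e : E.ext1 R X A) :
    (E.ext1Map R X f e : Ext X A' 1) = (e : Ext X A 1).comp (Ext.mk₀ f) (add_zero 1) :=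
  rfl

/-- Any absolute lift y of a relative class e along `S.f` is automatically relative: a map a from
`S.X₁` to a member of U is `S.f ≫ b` for some b, so a_* y = b_* e = 0. -/
lemma homExact_ext1Map_exact [EnoughProjectives C] (U : ObjectProperty C) {S : ShortComplex C}
    (hS : (homExact U).conf S) (X : C) :
    Function.Exact ((homExact U).ext1Map R X S.f) ((homExact U).ext1Map R X S.g) := by
  obtain ⟨hS', hU⟩ := (homExact_conf_iff _ _).1 hS
  rintro ⟨e, he⟩
  constructor
  · intro h
    obtain ⟨y, rfl⟩ := Ext.covariant_sequence_exact₂ X hS' e (congrArg Subtype.val h)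
    refine ⟨⟨y, (mem_ext1_homExact_iff R U y).2 fun M hM a => ?_⟩, rfl⟩
    obtain ⟨b, rfl⟩ := hU M hM a
    have := (mem_ext1_homExact_iff R U _).1 he M hM b
    rwa [Ext.comp_assoc _ _ _ (add_zero 1) (add_zero 0) (by lia), Ext.mk₀_comp_mk₀] at this
  · rintro ⟨⟨y, hy⟩, h⟩
    obtain rfl : y.comp (Ext.mk₀ S.f) (add_zero 1) = e := congrArg Subtype.val h
    refine Subtype.ext ?_
    rw [ext1Map_coe, Ext.comp_assoc _ _ _ (add_zero 1) (add_zero 0) (by lia), Ext.mk₀_comp_mk₀,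
      S.zero, Ext.mk₀_zero, Ext.comp_zero]
    rfl

end HomExact

/-! ### Vanishing of higher Yoneda Ext -/

section Yoneda

variable {C : Type u} [Category.{v} C] [Abelian C] {E : ExactStructure C}

lemma NExtension.Hom.refl {n : ℕ} {X A : C} (ε : E.NExtension n X A) :
    NExtension.Hom ε ε (𝟙 A) (𝟙 X) := by
  induction ε with
  | single f g w h => exact .single _ (𝟙 _) _ (by simp) (by simp)
  | splice f g w h ε ih => exact .splice _ (𝟙 _) (𝟙 _) _ (by simp) (by simp) ih

lemma conf_of_isIso (E : ExactStructure C) {S : ShortComplex C} (hS : S.ShortExact)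
    [IsIso S.f] : E.conf S := by
  obtain ⟨Z, g, w, h⟩ := E.id_inflation S.X₁
  refine E.conf_of_inflation hS ⟨Z, inv S.f ≫ g, by simpa using w, E.of_iso ?_ h⟩
  exact ShortComplex.isoMk (Iso.refl _) (asIso S.f) (Iso.refl _) (by simp) (by simp)

lemma conf_id_zero (E : ExactStructure C) (A : C) :
    E.conf (ShortComplex.mk (𝟙 A) (0 : A ⟶ 0) comp_zero) :=
  E.conf_of_isIso (S := ShortComplex.mk (𝟙 A) (0 : A ⟶ 0) comp_zero)
    (ShortComplex.Splitting.shortExact { r := 𝟙 A, s := 0 })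

lemma conf_zero_id (E : ExactStructure C) (X : C) :
    E.conf (ShortComplex.mk (0 : 0 ⟶ X) (𝟙 X) zero_comp) := by
  obtain ⟨Z, f, w, h⟩ := E.id_deflation X
  exact E.conf_of_deflation (S := ShortComplex.mk (0 : 0 ⟶ X) (𝟙 X) zero_comp)
    (ShortComplex.Splitting.shortExact { r := 0, s := 𝟙 X, f_r := (isZero_zero C).eq_of_src _ _ })
    ⟨Z, f, w, h⟩

/-- The split sequence is the direct sum of A → A → 0 and 0 → B → B. -/
lemma conf_biprod_inl_snd (E : ExactStructure C) (A B : C) :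
    E.conf (ShortComplex.mk (biprod.inl : A ⟶ A ⊞ B) biprod.snd biprod.inl_snd) := by
  have h0 {Z : C} (f g : (0 : C) ⟶ Z) : f = g := (isZero_zero C).eq_of_src f g
  have h0' {Z : C} (f g : Z ⟶ (0 : C)) : f = g := (isZero_zero C).eq_of_tgt f g
  have i₁ : (biprod.fst : A ⊞ 0 ⟶ A) ≫ biprod.inl = 𝟙 (A ⊞ 0) :=
    biprod.hom_ext _ _ (by simp) (h0' _ _)
  have i₂ : (biprod.snd : 0 ⊞ B ⟶ B) ≫ biprod.inr = 𝟙 (0 ⊞ B) :=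
    biprod.hom_ext _ _ (h0' _ _) (by simp)
  let e₁ : A ⊞ (0 : C) ≅ A := { hom := biprod.fst, inv := biprod.inl, hom_inv_id := i₁ }
  let e₃ : (0 : C) ⊞ B ≅ B := { hom := biprod.snd, inv := biprod.inr, hom_inv_id := i₂ }
  have h := E.conf_biprod (E.conf_id_zero A) (E.conf_zero_id B)
  refine E.of_iso (S := ShortComplex.mk _ _ _) (ShortComplex.isoMk e₁ (Iso.refl _) e₃ ?_ ?_) h
  · exact biprod.hom_ext' _ _ (by simp [e₁]) (h0 _ _)
  · simp [e₃]

/-- The trivial extension `0 ⟶ 0 ⟶ ⋯ ⟶ X ⟶ X`. -/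
noncomputable def zeroNExtension (E : ExactStructure C) (X : C) : (m : ℕ) → E.NExtension (m + 1) X 0
  | 0 => .single _ _ _ (E.conf_zero_id X)
  | m + 1 => .splice _ _ _ (E.conf_id_zero 0) (zeroNExtension E X m)

/-- The trivial extension `A ⟶ A ⟶ 0 ⟶ ⋯ ⟶ X ⟶ X`. -/
noncomputable def trivialNExtension (E : ExactStructure C) (X A : C) (m : ℕ) :
    E.NExtension (m + 2) X A :=
  .splice _ _ _ (E.conf_id_zero A) (E.zeroNExtension X m)

/-- Splicing a conflation on the left, on classes of extensions. -/
def YonedaExt.splice {n : ℕ} {A B K X : C} (f : A ⟶ B) (g : B ⟶ K) (w : f ≫ g = 0)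
    (h : E.conf (ShortComplex.mk f g w)) : E.YonedaExt n X K → E.YonedaExt (n + 1) X A :=
  Quot.map (NExtension.splice f g w h)
    fun _ _ hε => .splice _ (𝟙 _) (𝟙 _) _ (by simp) (by simp) hε

/-- An extension whose right part, an extension of `K`, receives a map from an extension of `B`
over `g : B ⟶ K` is trivial. -/
lemma quot_splice_eq_trivial {m : ℕ} {A B K X : C} (f : A ⟶ B) (g : B ⟶ K) (w : f ≫ g = 0)
    (h : E.conf (ShortComplex.mk f g w)) (ε : E.NExtension (m + 1) X K)
    (δ : E.NExtension (m + 1) X B) (hδ : NExtension.Hom δ ε g (𝟙 X))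
    (hδ' : NExtension.Hom δ (E.zeroNExtension X m) 0 (𝟙 X)) :
    (Quot.mk _ (.splice f g w h ε) : E.YonedaExt (m + 2) X A) =
      Quot.mk _ (E.trivialNExtension X A m) := by
  -- The intermediate extension A → A ⊕ B → B spliced with `δ` maps to the given one by (f, id) on A
  -- ⊕ B, and to the trivial one by projection to A.
  refine (Quot.sound (a := .splice _ _ _ (E.conf_biprod_inl_snd A B) δ) ?_).symm.trans
    (Quot.sound ?_)
  · exact .splice _ (biprod.desc f (𝟙 B)) g _ (by simp) (by ext <;> simp [w]) hδ
  · exact .splice _ biprod.fst 0 _ (by simp) (by simp) hδ'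

variable [HasExt.{w} C] (R : Type*) [CommRing R] [Linear R C]

/-- An exact structure whose relative `Ext¹` is right exact is hereditary. -/
theorem Ext1RightExact.isHereditary (hE : E.Ext1RightExact R) : E.IsHereditary := by
  suffices H : ∀ (m : ℕ) (X A : C) (x : E.YonedaExt (m + 2) X A),
      x = Quot.mk _ (E.trivialNExtension X A m) by
    intro n hn X A
    obtain ⟨m, rfl⟩ := Nat.exists_eq_add_of_le' hn
    exact ⟨fun x y => (H m X A x).trans (H m X A y).symm⟩
  intro m
  induction m with
  | zero =>
    rintro X A ⟨ε⟩
    obtain _ | @⟨_, _, B, K, _, f, g, w, h, ε⟩ := ε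
    obtain @⟨_, B', _, f', g', w', h'⟩ | @⟨_, _, _, _, _, _, _, _, _, ε⟩ := ε
    swap
    · exact nomatch ε
    -- Surjectivity of relative Ext¹ along `g` lifts the class of the right-hand conflation to a
    -- class over B, realized by a conflation that serves as δ.
    obtain ⟨⟨e, B'', i, p, z, hc, he⟩, hg⟩ := (hE _ h X).2 ⟨_, _, _, _, _, h', rfl⟩
    have hg : e.comp (Ext.mk₀ g) (add_zero 1) = _ := congrArg Subtype.val hg
    obtain ⟨b, hb₁, hb₂⟩ := exists_hom_of_extClass_comp_eq (E.shortExact hc) (E.shortExact h')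
      g (𝟙 X) (by simpa [he] using hg)
    refine quot_splice_eq_trivial f g w h _ (.single i p z hc) ?_ ?_
    · exact .single _ b _ hb₁ hb₂.symm
    · exact .single _ p _ (by rw [z, zero_comp]) (by rw [Category.comp_id])
  | succ m ih =>
    rintro X A ⟨ε⟩
    obtain _ | @⟨_, _, B, K, _, f, g, w, h, ε⟩ := ε
    have h₀ : NExtension.Hom (E.zeroNExtension X m) (E.zeroNExtension X m) 0 (𝟙 X) := by
      rw [← id_zero]
      exact .refl _
    -- By induction the right part may be replaced by the trivial extension of X by K, which
    -- receives the trivial extension of X by B over `g`. Right exactness is used only in the base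
    -- case.
    have h₁ := congrArg (YonedaExt.splice f g w h) (ih X K (Quot.mk _ ε))
    refine h₁.trans (quot_splice_eq_trivial f g w h _ (E.trivialNExtension X B m) ?_ ?_)
    · exact .splice _ g 0 _ (by simp) (by simp) h₀
    · exact .splice _ 0 0 _ (by simp) (by simp) h₀

end Yoneda

end ExactStructure


/-! ### Ext of finitely generated modules, and Ext² = 0 over a principal ideal domain -/

section FiniteModules

section

variable {R : Type u} [CommRing R]

lemma sum_hom {M N : FGModuleCat.{u} R} {ι : Type*} (s : Finset ι) (f : ι → (M ⟶ N)) :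
    (∑ i ∈ s, f i).hom.hom = ∑ i ∈ s, (f i).hom.hom :=
  map_sum (AddMonoidHom.mk' (fun g : M ⟶ N => g.hom.hom) fun _ _ => rfl) f s

lemma map_torsion_eq_zero [IsDomain R] {M : FGModuleCat.{u} R} (f : M ⟶ FGModuleCat.of R R) {x : M}
    (hx : x ∈ Submodule.torsion R M) : f.hom.hom x = 0 := by
  obtain ⟨a, ha⟩ := hx
  have h : (a : R) • f.hom.hom x = 0 := by
    rw [← map_smul]
    exact (congrArg _ ha).trans (map_zero _)
  exact (mul_eq_zero.1 h).resolve_left (nonZeroDivisors.coe_ne_zero a)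

end

variable {R : Type u} [CommRing R] [IsNoetherianRing R]

lemma epi_iff {M N : FGModuleCat.{u} R} (f : M ⟶ N) :
    Epi f ↔ Function.Surjective f.hom.hom := by
  rw [← Functor.epi_map_iff_epi (forget₂ (FGModuleCat.{u} R) (ModuleCat.{u} R)),
    ModuleCat.epi_iff_surjective]
  rfl

lemma projective_of_module_projective (M : FGModuleCat.{u} R) [Module.Projective R M] :
    Projective M where
  factors {E X} f e he := by
    obtain ⟨h, hh⟩ := Module.projective_lifting_property e.hom.hom f.hom.hom ((epi_iff e).1 he)
    exact ⟨FGModuleCat.ofHom h, FGModuleCat.hom_ext hh⟩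

lemma exists_free_cover (X : FGModuleCat.{u} R) :
    ∃ (k : ℕ) (g : FGModuleCat.of R (Fin k → R) ⟶ X), Epi g := by
  obtain ⟨k, f, hf⟩ := Module.Finite.exists_fin' R X
  exact ⟨k, FGModuleCat.ofHom (W := X) f, (epi_iff _).2 hf⟩

instance : EnoughProjectives (FGModuleCat.{u} R) where
  presentation X := by
    obtain ⟨k, g, hg⟩ := exists_free_cover X
    exact ⟨{ p := _, projective := projective_of_module_projective _, f := g }⟩

lemma ext_of_free_eq_zero {Y : FGModuleCat.{u} R} (e : Ext (FGModuleCat.of R R) Y 1) : e = 0 := by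
  have := projective_of_module_projective (FGModuleCat.of R R)
  exact Ext.eq_zero_of_projective e

variable [IsDomain R] [IsPrincipalIdealRing R]

lemma projective_of_mono {k : ℕ} {M : FGModuleCat.{u} R}
    (f : M ⟶ FGModuleCat.of R (Fin k → R)) [Mono f] : Projective M := by
  have hf := (mono_iff R f).1 inferInstance
  have : Module.IsTorsionFree R M := hf.moduleIsTorsionFree f.hom.hom fun r m => map_smul _ r m
  have : Module.Free R M := Module.free_of_finite_type_torsion_free'
  exact projective_of_module_projective M

/-- The kernel of a finite free cover of X is a submodule of a free module, hence projective, so X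
has a projective resolution of length one. -/
lemma ext_two_eq_zero {X Y : FGModuleCat.{u} R} (e : Ext X Y 2) : e = 0 := by
  obtain ⟨k, g, hg⟩ := exists_free_cover X
  have := projective_of_module_projective (FGModuleCat.of R (Fin k → R))
  have := projective_of_mono (kernel.ι g)
  obtain ⟨x, rfl⟩ := Ext.contravariant_sequence_exact₃ (ExactStructure.shortExact_kernel g) Y e
    (Ext.eq_zero_of_projective _) (show 1 + 1 = 2 from rfl)
  have hx : x = 0 := Ext.eq_zero_of_projective x
  rw [hx, Ext.comp_zero]

lemma ext_one_surjective {Y Z : FGModuleCat.{u} R} (g : Y ⟶ Z) [Epi g]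
    {X : FGModuleCat.{u} R} (e : Ext X Z 1) :
    ∃ e' : Ext X Y 1, e'.comp (Ext.mk₀ g) (add_zero 1) = e :=
  Ext.covariant_sequence_exact₃ X (ExactStructure.shortExact_kernel g) e
    (show 1 + 1 = 2 from rfl) (ext_two_eq_zero _)

/-- Although `f` need not be mono, Ext¹(X, -) is right exact: the class comes from the image of `f`
by the long exact sequence, and then from Y because Y → im f is epi and Ext² = 0. -/
lemma exists_comp_eq_of_comp_cokernel_eq_zero {X Y Z : FGModuleCat.{u} R} (f : Y ⟶ Z)
    (e : Ext X Z 1) (he : e.comp (Ext.mk₀ (cokernel.π f)) (add_zero 1) = 0) :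
    ∃ e' : Ext X Y 1, e'.comp (Ext.mk₀ f) (add_zero 1) = e := by
  obtain ⟨y, rfl⟩ := Ext.covariant_sequence_exact₂ X
    (ExactStructure.shortExact_kernel (cokernel.π f)) e he
  obtain ⟨z, rfl⟩ := ext_one_surjective (Abelian.factorThruImage f) y
  refine ⟨z, ?_⟩
  rw [Ext.comp_assoc _ _ _ (add_zero 1) (add_zero 0) (by lia), Ext.mk₀_comp_mk₀]
  congr 2
  exact (Abelian.image.fac f).symm

end FiniteModules

/-! ### The torsion functor and E' as a Hom-exact structure -/

section Torsion

variable {R : Type u} [CommRing R] [IsNoetherianRing R]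

/-- The inclusion of the torsion submodule. -/
def torsionι (M : FGModuleCat.{u} R) : (torsionFunctor R).obj M ⟶ M :=
  FGModuleCat.ofHom (W := M) (Submodule.torsion R M).subtype

lemma torsionFunctor_map_ι {M N : FGModuleCat.{u} R} (f : M ⟶ N) :
    (torsionFunctor R).map f ≫ torsionι N = torsionι M ≫ f :=
  rfl

lemma torsionFunctor_epi_iff {M N : FGModuleCat.{u} R} (f : M ⟶ N) :
    Epi ((torsionFunctor R).map f) ↔ ∀ y ∈ Submodule.torsion R N,
      ∃ x ∈ Submodule.torsion R M, f.hom.hom x = y := by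
  rw [epi_iff]
  constructor
  · intro h y hy
    obtain ⟨x, hx⟩ := h ⟨y, hy⟩
    exact ⟨x.1, x.2, congrArg Subtype.val hx⟩
  · rintro h ⟨y, hy⟩
    obtain ⟨x, hx, hxy⟩ := h y hy
    exact ⟨⟨x, hx⟩, Subtype.ext hxy⟩

variable [IsDomain R]

lemma torsionι_comp {M : FGModuleCat.{u} R} (f : M ⟶ FGModuleCat.of R R) : torsionι M ≫ f = 0 :=
  FGModuleCat.hom_ext (LinearMap.ext fun x => map_torsion_eq_zero f x.2)

variable [IsPrincipalIdealRing R]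

/-- A finitely generated module over a principal ideal domain is the direct sum of its torsion
submodule and a free module. -/
lemma exists_torsion_free_decomposition (M : FGModuleCat.{u} R) :
    ∃ (k : ℕ) (f : Fin k → (M ⟶ FGModuleCat.of R R)) (s : Fin k → (FGModuleCat.of R R ⟶ M))
      (ρ : M ⟶ (torsionFunctor R).obj M), ρ ≫ torsionι M + ∑ i, f i ≫ s i = 𝟙 M := by
  let T := Submodule.torsion R M
  obtain ⟨σ, hσ⟩ := Module.projective_lifting_property T.mkQ LinearMap.id T.mkQ_surjective
  let b := Module.finBasis R (M ⧸ T)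
  have hρ (x : M) : (LinearMap.id - σ ∘ₗ T.mkQ : M →ₗ[R] M) x ∈ T := by
    refine (Submodule.Quotient.mk_eq_zero T).1 ?_
    simpa [sub_eq_zero] using (LinearMap.congr_fun hσ (T.mkQ x)).symm
  refine ⟨_, fun i => FGModuleCat.ofHom (V := M) (b.coord i ∘ₗ T.mkQ),
    fun i => FGModuleCat.ofHom (W := M) (LinearMap.toSpanSingleton R M (σ (b i))),
    FGModuleCat.ofHom (V := M) (LinearMap.codRestrict T _ hρ), FGModuleCat.hom_ext ?_⟩
  refine LinearMap.ext fun x => ?_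
  have h : ∑ i, b.repr (T.mkQ x) i • σ (b i) = σ (T.mkQ x) := by
    simp only [← map_smul, ← map_sum, b.sum_repr]
  change (x - σ (T.mkQ x)) + (∑ i, _ : M ⟶ M).hom.hom x = x
  rw [sum_hom, LinearMap.sum_apply, sub_add_eq_add_sub, sub_eq_iff_eq_add, ← h]
  rfl

/-- A short exact sequence is exact on torsion submodules if and only if `Hom(-, R)` is exact
on it. -/
lemma torsionExactStructure_eq_homExact :
    ExactStructure.functorExact (torsionFunctor R) =
      ExactStructure.homExact (fun M : FGModuleCat.{u} R => M = FGModuleCat.of R R) := by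
  have hE (S : ShortComplex (FGModuleCat.{u} R)) :
      (ExactStructure.functorExact (torsionFunctor R)).conf S ↔
        S.ShortExact ∧ Epi ((torsionFunctor R).map S.g) :=
    and_congr_right fun hS => ExactStructure.map_shortExact_iff _ hS
  refine ExactStructure.ext (funext fun S => propext ?_)
  rw [ExactStructure.homExact_conf_iff]
  refine ⟨fun h => ?_, fun h => ?_⟩
  · have hS := ((hE S).1 h).1
    refine ⟨hS, ?_⟩
    rintro _ rfl a
    rw [← extClass_comp_mk₀_eq_zero_iff hS]
    have hr : (ExactStructure.functorExact (torsionFunctor R)).IsRealized hS.extClass :=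
      ⟨_, _, _, _, h, rfl⟩
    -- After pushout along `a` the left end is R, and the resulting sequence R → B → `S.X₃` must be
    -- shown to split. As R is torsion-free, B_tors → (`S.X₃`)_tors is injective, hence an
    -- isomorphism, and its inverse splits the sequence over the torsion part. Over the free part
    -- Ext¹ vanishes.
    obtain ⟨B, i, g, w, hc, he⟩ := hr.postcomp a
    rw [← he]
    obtain ⟨hT, hg⟩ := (hE _).1 hc
    have hi := (mono_iff R i).1 hT.mono_f
    have hg := (torsionFunctor_epi_iff _).1 hg
    obtain ⟨k, f, s, ρ, hρ⟩ := exists_torsion_free_decomposition S.X₃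
    have hinj : Function.Injective ((torsionFunctor R).map g).hom.hom := by
      refine (injective_iff_map_eq_zero _).2 fun x hx => ?_
      obtain ⟨r, hr⟩ := (exact_iff R _).1 hT.exact x.1 (congrArg Subtype.val hx)
      obtain ⟨c, hc⟩ := x.2
      have hr₀ : r = 0 := by
        have h : (c : R) • r = 0 := by
          apply hi
          rw [map_smul, map_zero]
          exact (congrArg _ hr).trans hc
        exact (mul_eq_zero.1 h).resolve_left (nonZeroDivisors.coe_ne_zero c)
      refine Subtype.ext (hr.symm.trans ?_)
      rw [hr₀]
      exact map_zero _
    have : Mono ((torsionFunctor R).map g) := (mono_iff R _).2 hinj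
    have : Epi ((torsionFunctor R).map g) := (torsionFunctor_epi_iff g).2 hg
    have : IsIso ((torsionFunctor R).map g) := isIso_of_mono_of_epi _
    have h₁ : (Ext.mk₀ (ρ ≫ torsionι S.X₃)).comp hT.extClass (zero_add 1) = 0 :=
      (mk₀_comp_extClass_eq_zero_iff hT _).2
        ⟨ρ ≫ inv ((torsionFunctor R).map g) ≫ torsionι B, by
          simp [← torsionFunctor_map_ι]⟩
    rw [← Ext.mk₀_id_comp hT.extClass]
    change (Ext.mk₀ (𝟙 S.X₃)).comp hT.extClass (zero_add 1) = 0
    rw [← hρ, Ext.mk₀_add, Ext.add_comp, h₁, zero_add, Ext.mk₀_sum, Ext.sum_comp]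
    refine Finset.sum_eq_zero fun i _ => ?_
    rw [← Ext.mk₀_comp_mk₀_assoc, ext_of_free_eq_zero ((Ext.mk₀ (s i)).comp _ _), Ext.comp_zero]
  · obtain ⟨hS, hf⟩ := h
    refine (hE S).2 ⟨hS, (torsionFunctor_epi_iff _).2 fun x hx => ?_⟩
    obtain ⟨b, rfl⟩ := (epi_iff S.g).1 hS.epi_g x
    obtain ⟨c, hc⟩ := hx
    obtain ⟨k, f, s, ρ, hρ⟩ := exists_torsion_free_decomposition S.X₁
    choose F hF using fun i => hf _ rfl (f i)
    -- The endomorphism `q` removes the free part of `S.X₁`: it induces the identity on `S.X₃` and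
    -- sends `S.X₁` into its torsion. If c kills the image of b, then c b lies in `S.X₁`, so c q(b)
    -- is torsion, and q(b) is a torsion lift.
    let q : S.X₂ ⟶ S.X₂ := 𝟙 _ - ∑ i, F i ≫ s i ≫ S.f
    have hq : q ≫ S.g = S.g := by
      simp [q, Preadditive.sub_comp, Preadditive.sum_comp]
    have hq' : S.f ≫ q = ρ ≫ torsionι _ ≫ S.f := by
      have : (ρ ≫ torsionι S.X₁) ≫ S.f = (𝟙 _ - ∑ i, f i ≫ s i) ≫ S.f := by
        rw [← hρ, add_sub_cancel_right]
      rw [Category.assoc] at this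
      rw [this]
      simp [q, Preadditive.sub_comp, Preadditive.comp_sub, Preadditive.sum_comp,
        Preadditive.comp_sum, ← hF]
    refine ⟨q.hom.hom b, ?_, LinearMap.congr_fun (congrArg (·.hom.hom) hq) b⟩
    obtain ⟨y, hy⟩ := (exact_iff R S).1 hS.exact ((c : R) • b) ((map_smul _ _ _).trans hc)
    obtain ⟨d, hd⟩ := (ρ.hom.hom y).2
    refine ⟨d * c, ?_⟩
    have h₁ : (c : R) • q.hom.hom b = S.f.hom.hom (ρ.hom.hom y).1 := by
      rw [← map_smul, ← hy]
      exact LinearMap.congr_fun (congrArg (·.hom.hom) hq') y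
    rw [mul_smul]
    change (d : R) • (c : R) • q.hom.hom b = 0
    rw [h₁, ← map_smul]
    exact (congrArg _ hd).trans (map_zero _)

end Torsion


/-! ### Relative Ext¹ over a discrete valuation ring -/

section DiscreteValuationRing

variable {R : Type u} [CommRing R] [IsDomain R] [IsDiscreteValuationRing R]

lemma mem_rad_iff {ϖ : R} (hϖ : Irreducible ϖ) (n : ℕ) {M : Type*} [AddCommGroup M] [Module R M]
    (x : M) : x ∈ rad R n M ↔ ∃ y : M, ϖ ^ n • y = x := by
  rw [rad, hϖ.maximalIdeal_eq, Ideal.span_singleton_pow, Submodule.ideal_span_singleton_smul,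
    Submodule.mem_smul_pointwise_iff_exists]
  simp

/-- A finitely generated module killed by `Pⁿ` is a direct sum of modules `R/P^ℓ`, `ℓ ≤ n`. -/
lemma exists_cyclic_decomposition {ϖ : R} (hϖ : Irreducible ϖ) (n : ℕ) (N : FGModuleCat.{u} R)
    (hN : ∀ x : N, ϖ ^ n • x = 0) :
    ∃ (ι : Type u) (_ : Fintype ι) (M : ι → FGModuleCat.{u} R) (f : ∀ i, N ⟶ M i)
      (s : ∀ i, M i ⟶ N), (∀ i, cyclicModules R (Set.Iic n) (M i)) ∧ ∑ i, f i ≫ s i = 𝟙 N := by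
  classical
  have ht : Module.IsTorsion R N := fun x =>
    ⟨⟨ϖ ^ n, mem_nonZeroDivisors_of_ne_zero (pow_ne_zero n hϖ.ne_zero)⟩, hN x⟩
  obtain ⟨ι, hι, p, hp, e, ⟨Ψ⟩⟩ := Module.equiv_directSum_of_isTorsion ht
  let Φ : N ≃ₗ[R] DirectSum ι fun i => R ⧸ Ideal.span {p i ^ e i} := Ψ
  refine ⟨ι, hι, fun i => FGModuleCat.of R (R ⧸ Ideal.span {p i ^ e i}),
    fun i => FGModuleCat.ofHom (V := N) (DirectSum.component R ι _ i ∘ₗ Φ.toLinearMap),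
    fun i => FGModuleCat.ofHom (W := N)
      (Φ.symm.toLinearMap ∘ₗ DirectSum.lof R ι (fun i => R ⧸ Ideal.span {p i ^ e i}) i),
    fun i => ⟨e i, ?_, ?_⟩, FGModuleCat.hom_ext (LinearMap.ext fun x => ?_)⟩
  -- The exponent is bounded because ϖⁿ kills the generator of the i-th summand, so `p i ^ e i`
  -- divides ϖⁿ. The exponent 0 is not excluded.
  · have h₁ : ϖ ^ n • DirectSum.lof R ι (fun i => R ⧸ Ideal.span {p i ^ e i}) i
        (Ideal.Quotient.mk _ 1) = 0 := by
      apply Φ.symm.injective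
      rw [map_smul, map_zero]
      exact hN _
    have h₂ := congrArg (DirectSum.component R ι (fun i => R ⧸ Ideal.span {p i ^ e i}) i) h₁
    rw [map_smul, DirectSum.component.lof_self, map_zero, ← Ideal.Quotient.mkₐ_eq_mk R, ← map_smul,
      Ideal.Quotient.mkₐ_eq_mk, Ideal.Quotient.eq_zero_iff_mem, Ideal.mem_span_singleton,
      smul_eq_mul, mul_one] at h₂
    have h₃ : p i ^ e i ∣ p i ^ n := h₂.trans
      ((IsDiscreteValuationRing.associated_of_irreducible R hϖ (hp i)).pow_pow.dvd)
    exact (pow_dvd_pow_iff (hp i).ne_zero (hp i).not_isUnit).1 h₃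
  · have hI (I J : Ideal R) (h : I = J) :
        FGModuleCat.of R (R ⧸ I) = FGModuleCat.of R (R ⧸ J) := by subst h; rfl
    exact hI _ _ (by rw [(hp i).maximalIdeal_eq, Ideal.span_singleton_pow])
  · rw [sum_hom, LinearMap.sum_apply]
    change ∑ i, Φ.symm (DirectSum.lof R ι _ i (Φ x i)) = x
    rw [← map_sum]
    exact (congrArg Φ.symm (DirectSum.sum_univ_of (Φ x))).trans (Φ.symm_apply_apply x)

/-- By bilinearity the scalar ϖⁿ moves from the class to `f`, where it acts as zero because the
target R/P^ℓ has ℓ ≤ n. -/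
lemma comp_cyclic_eq_zero {ϖ : R} (hϖ : Irreducible ϖ) {n : ℕ} {X Y M : FGModuleCat.{u} R}
    (hM : cyclicModules R (Set.Icc 1 n) M) (e : Ext X Y 1) (f : Y ⟶ M) :
    (ϖ ^ n • e).comp (Ext.mk₀ f) (add_zero 1) = 0 := by
  obtain ⟨ℓ, ⟨-, hℓ⟩, rfl⟩ := hM
  have h : ϖ ^ n • f = 0 := by
    refine FGModuleCat.hom_ext (LinearMap.ext fun x => ?_)
    obtain ⟨r, hr⟩ := Ideal.Quotient.mk_surjective (f.hom.hom x)
    change ϖ ^ n • f.hom.hom x = 0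
    rw [← hr]
    refine Ideal.Quotient.eq_zero_iff_mem.2 (Ideal.mul_mem_right _ _ ?_)
    exact Ideal.pow_le_pow_right hℓ
      (Ideal.pow_mem_pow (by simp [hϖ.maximalIdeal_eq]) n)
  rw [Ext.smul_comp, ← Ext.comp_smul, ← Ext.mk₀_smul, h, Ext.mk₀_zero, Ext.comp_zero]

lemma mem_ext1_homExactStructure_iff {ϖ : R} (hϖ : Irreducible ϖ) (n : ℕ)
    {X Y : FGModuleCat.{u} R} (e : Ext X Y 1) :
    e ∈ (homExactStructure R (Set.Icc 1 n)).ext1 R X Y ↔ ∃ e' : Ext X Y 1, ϖ ^ n • e' = e := by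
  refine (ExactStructure.mem_ext1_homExact_iff R _ e).trans ⟨fun h => ?_, ?_⟩
  -- Y/ϖⁿY is decomposed so that the image of `e` in Ext¹(X, Y/ϖⁿY) can be killed one cyclic summand
  -- at a time.
  · obtain ⟨ι, _, M, f, s, hM, hsum⟩ := exists_cyclic_decomposition hϖ n
      (cokernel (ϖ ^ n • 𝟙 Y)) fun x => by
        obtain ⟨y, rfl⟩ := (epi_iff (cokernel.π (ϖ ^ n • 𝟙 Y))).1 inferInstance x
        rw [← map_smul]
        exact LinearMap.congr_fun (congrArg (·.hom.hom) (cokernel.condition (ϖ ^ n • 𝟙 Y))) y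
    obtain ⟨e', he'⟩ := exists_comp_eq_of_comp_cokernel_eq_zero (ϖ ^ n • 𝟙 Y) e (by
      rw [← Category.comp_id (cokernel.π _), ← hsum, Preadditive.comp_sum, Ext.mk₀_sum,
        Ext.comp_sum]
      refine Finset.sum_eq_zero fun i _ => ?_
      rw [← Category.assoc, ← Ext.mk₀_comp_mk₀,
        ← Ext.comp_assoc _ _ _ (add_zero 1) (add_zero 0) (by lia)]
      obtain ⟨ℓ, hℓ, hi⟩ := hM i
      -- Since L starts at 1, the hypothesis says nothing about ℓ = 0, but that summand is the zero
      -- module.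
      obtain rfl | hℓ₀ := Nat.eq_zero_or_pos ℓ
      · have h0 : s i = 0 := by
          have : Subsingleton (M i) := by
            rw [hi]
            exact Ideal.Quotient.subsingleton_iff.2 (by rw [pow_zero, Ideal.one_eq_top])
          refine FGModuleCat.hom_ext (LinearMap.ext fun x => ?_)
          rw [Subsingleton.elim x 0, map_zero, map_zero]
        rw [h0, Ext.mk₀_zero, Ext.comp_zero]
      · rw [h _ ⟨ℓ, ⟨hℓ₀, hℓ⟩, hi⟩, Ext.zero_comp])
    exact ⟨e', by rw [Ext.smul_eq_comp_mk₀, he']⟩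
  · rintro ⟨e', rfl⟩ M hM f
    exact comp_cyclic_eq_zero hϖ hM e' f

lemma mem_ext1_torsionExactStructure_iff {X Y : FGModuleCat.{u} R} (e : Ext X Y 1) :
    e ∈ (torsionExactStructure R).ext1 R X Y ↔
      ∀ f : Y ⟶ FGModuleCat.of R R, e.comp (Ext.mk₀ f) (add_zero 1) = 0 := by
  rw [torsionExactStructure, torsionExactStructure_eq_homExact,
    ExactStructure.mem_ext1_homExact_iff]
  simp

/-- This form makes the general membership criterion and middle exactness available for E'_L. -/
lemma homTorsionExactStructure_eq_homExact (L : Set ℕ) : homTorsionExactStructure R L =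
    ExactStructure.homExact (cyclicModules R L ⊔ fun M => M = FGModuleCat.of R R) := by
  rw [homTorsionExactStructure, homExactStructure, torsionExactStructure,
    torsionExactStructure_eq_homExact, ExactStructure.homExact_inf]

lemma mem_ext1_homTorsionExactStructure_iff (L : Set ℕ) {X Y : FGModuleCat.{u} R}
    (e : Ext X Y 1) : e ∈ (homTorsionExactStructure R L).ext1 R X Y ↔
      e ∈ (homExactStructure R L).ext1 R X Y ∧ e ∈ (torsionExactStructure R).ext1 R X Y := by
  rw [homTorsionExactStructure_eq_homExact, torsionExactStructure,
    torsionExactStructure_eq_homExact, homExactStructure]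
  simp only [ExactStructure.mem_ext1_homExact_iff]
  exact ⟨fun h => ⟨fun M hM => h M (Or.inl hM), fun M hM => h M (Or.inr hM)⟩,
    fun h M hM => hM.elim (h.1 M) (h.2 M)⟩

/-- An extension class that is killed by all maps to `R` comes from the torsion submodule. -/
lemma comp_torsion_projection {X Y : FGModuleCat.{u} R} {k : ℕ}
    {f : Fin k → (Y ⟶ FGModuleCat.of R R)} {s : Fin k → (FGModuleCat.of R R ⟶ Y)}
    {ρ : Y ⟶ (torsionFunctor R).obj Y} (hρ : ρ ≫ torsionι Y + ∑ i, f i ≫ s i = 𝟙 Y)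
    {e : Ext X Y 1} (he : e ∈ (torsionExactStructure R).ext1 R X Y) :
    (e.comp (Ext.mk₀ ρ) (add_zero 1)).comp (Ext.mk₀ (torsionι Y)) (add_zero 1) = e := by
  have h : ∑ i, e.comp (Ext.mk₀ (f i ≫ s i)) (add_zero 1) = 0 := by
    refine Finset.sum_eq_zero fun i _ => ?_
    rw [← Ext.mk₀_comp_mk₀, ← Ext.comp_assoc _ _ _ (add_zero 1) (add_zero 0) (by lia),
      (mem_ext1_torsionExactStructure_iff e).1 he, Ext.zero_comp]
  rw [Ext.comp_assoc _ _ _ (add_zero 1) (add_zero 0) (by lia), Ext.mk₀_comp_mk₀]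
  conv_rhs => rw [← Ext.comp_mk₀_id e, ← hρ, Ext.mk₀_add, Ext.comp_add, Ext.mk₀_sum, Ext.comp_sum,
    h, add_zero]

lemma comp_torsionι_mem {X Y : FGModuleCat.{u} R} (e : Ext X ((torsionFunctor R).obj Y) 1) :
    e.comp (Ext.mk₀ (torsionι Y)) (add_zero 1) ∈ (torsionExactStructure R).ext1 R X Y := by
  rw [mem_ext1_torsionExactStructure_iff]
  intro f
  rw [Ext.comp_assoc _ _ _ (add_zero 1) (add_zero 0) (by lia), Ext.mk₀_comp_mk₀, torsionι_comp,
    Ext.mk₀_zero, Ext.comp_zero]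

/-- `Ext¹_{E'_L} = Pⁿ Ext¹_{E'}` for `L = {1, …, n}`. -/
lemma mem_ext1_homTorsionExactStructure_Icc_iff {ϖ : R} (hϖ : Irreducible ϖ) (n : ℕ)
    {X Y : FGModuleCat.{u} R} (e : Ext X Y 1) :
    e ∈ (homTorsionExactStructure R (Set.Icc 1 n)).ext1 R X Y ↔
      ∃ e' ∈ (torsionExactStructure R).ext1 R X Y, ϖ ^ n • e' = e := by
  rw [mem_ext1_homTorsionExactStructure_iff, mem_ext1_homExactStructure_iff hϖ]
  constructor
  · rintro ⟨⟨e, rfl⟩, h⟩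
    obtain ⟨k, f, s, ρ, hρ⟩ := exists_torsion_free_decomposition Y
    -- The quotient class `e` need not be relative for E', but its image under the projection of Y
    -- onto its torsion is. That projection fixes ϖⁿ e, which is relative.
    refine ⟨_, comp_torsionι_mem (e.comp (Ext.mk₀ ρ) (add_zero 1)), ?_⟩
    rw [← Ext.smul_comp, ← Ext.smul_comp, comp_torsion_projection hρ h]
  · rintro ⟨e', h, rfl⟩
    exact ⟨⟨e', rfl⟩, Submodule.smul_mem _ _ h⟩

lemma homExactStructure_ext1RightExact (n : ℕ) :
    (homExactStructure R (Set.Icc 1 n)).Ext1RightExact R := by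
  obtain ⟨ϖ, hϖ⟩ := IsDiscreteValuationRing.exists_irreducible R
  intro S hS X
  refine ⟨ExactStructure.homExact_ext1Map_exact R _ hS X, ?_⟩
  rintro ⟨e, he⟩
  obtain ⟨e', rfl⟩ := (mem_ext1_homExactStructure_iff hϖ n e).1 he
  have : Epi S.g := (ExactStructure.shortExact _ hS).epi_g
  -- It is `e'` that is lifted, not `e`: an arbitrary lift of `e` need not be relative, while ϖⁿ
  -- times any class is.
  obtain ⟨y, rfl⟩ := ext_one_surjective S.g e'
  exact ⟨⟨ϖ ^ n • y, (mem_ext1_homExactStructure_iff hϖ n _).2 ⟨y, rfl⟩⟩,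
    Subtype.ext (Ext.smul_comp _ _ _ _)⟩

lemma homTorsionExactStructure_ext1RightExact (n : ℕ) :
    (homTorsionExactStructure R (Set.Icc 1 n)).Ext1RightExact R := by
  obtain ⟨ϖ, hϖ⟩ := IsDiscreteValuationRing.exists_irreducible R
  intro S hS X
  constructor
  · rw [homTorsionExactStructure_eq_homExact] at hS ⊢
    exact ExactStructure.homExact_ext1Map_exact R _ hS X
  · rintro ⟨e, he⟩
    obtain ⟨e', h, rfl⟩ := (mem_ext1_homTorsionExactStructure_Icc_iff hϖ n e).1 he
    obtain ⟨k, f, s, ρ, hρ⟩ := exists_torsion_free_decomposition S.X₃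
    have hS' : (S.map (torsionFunctor R)).ShortExact := hS.2.2
    have : Epi ((torsionFunctor R).map S.g) := hS'.epi_g
    -- Lifting between torsion submodules, where `S.g` stays epi because the sequence is E'-exact,
    -- keeps the lift inside Ext¹_{E'} after composition with the inclusion.
    obtain ⟨y, hy⟩ := ext_one_surjective ((torsionFunctor R).map S.g)
      (e'.comp (Ext.mk₀ ρ) (add_zero 1))
    have hy' := (mem_ext1_homTorsionExactStructure_Icc_iff hϖ n _).2
      ⟨_, comp_torsionι_mem y, rfl⟩
    refine ⟨⟨_, hy'⟩, Subtype.ext ?_⟩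
    rw [ExactStructure.ext1Map_coe, Ext.smul_comp,
      Ext.comp_assoc _ _ _ (add_zero 1) (add_zero 0) (by lia), Ext.mk₀_comp_mk₀,
      ← torsionFunctor_map_ι, ← Ext.mk₀_comp_mk₀,
      ← Ext.comp_assoc _ _ _ (add_zero 1) (add_zero 0) (by lia), hy, comp_torsion_projection hρ h]

end DiscreteValuationRing

end RelExt

theorem mainTheorem9 (R : Type u) [CommRing R] [IsDomain R] [IsDiscreteValuationRing R] (n : ℕ) :
    -- `Ext¹_{E_L} = radⁿ Ext¹_R`
    (∀ X Y : FGModuleCat.{u} R,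
      (RelExt.homExactStructure R (Set.Icc 1 n)).ext1 R X Y =
        RelExt.rad R n (CategoryTheory.Abelian.Ext X Y 1)) ∧
    -- `Ext¹_{E'_L} = radⁿ Ext¹_{E'}`
    (∀ X Y : FGModuleCat.{u} R,
      (RelExt.homTorsionExactStructure R (Set.Icc 1 n)).ext1 R X Y =
        (RelExt.rad R n ((RelExt.torsionExactStructure R).ext1 R X Y)).map
          ((RelExt.torsionExactStructure R).ext1 R X Y).subtype) ∧
    (RelExt.homExactStructure R (Set.Icc 1 n)).Ext1RightExact R ∧
    (RelExt.homTorsionExactStructure R (Set.Icc 1 n)).Ext1RightExact R ∧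
    (RelExt.homExactStructure R (Set.Icc 1 n)).IsHereditary ∧
    (RelExt.homTorsionExactStructure R (Set.Icc 1 n)).IsHereditary := by
  obtain ⟨ϖ, hϖ⟩ := IsDiscreteValuationRing.exists_irreducible R
  have h₁ := RelExt.homExactStructure_ext1RightExact (R := R) n
  have h₂ := RelExt.homTorsionExactStructure_ext1RightExact (R := R) n
  refine ⟨fun X Y => ?_, fun X Y => ?_, h₁, h₂, h₁.isHereditary R, h₂.isHereditary R⟩
  · ext e
    rw [RelExt.mem_ext1_homExactStructure_iff hϖ, RelExt.mem_rad_iff hϖ]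
  · ext e
    rw [RelExt.mem_ext1_homTorsionExactStructure_Icc_iff hϖ, Submodule.mem_map]
    constructor
    · rintro ⟨e', h, rfl⟩
      let y : (RelExt.torsionExactStructure R).ext1 R X Y := ⟨e', h⟩
      exact ⟨ϖ ^ n • y, (RelExt.mem_rad_iff hϖ n _).2 ⟨y, rfl⟩, rfl⟩
    · rintro ⟨x, hx, rfl⟩
      obtain ⟨y, rfl⟩ := (RelExt.mem_rad_iff hϖ n x).1 hx
      exact ⟨y, y.2, rfl⟩
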